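/- Let $\mathfrak l$ be a finite-dimensional complex reductive Lie algebra with one-dimensional center, put $\mathfrak h=[\mathfrak l,\mathfrak l]$, and let $W$ be a finite-dimensional faithful irreducible $\mathfrak l$-module on which the center acts nontrivially. Suppose that $\Lambda^2W$ is irreducible (or zero, which happens exactly when $\dim W=1$). Suppose moreover that $W$ is endowed with a nonzero $\mathfrak h$-invariant cubic form $C\in S^3W^*$, and that, as an $\mathfrak h$-module, $S^2W=P\oplus S$ with $P\cong W^*$ and with $S$ irreducible (or zero). For $r,t\in W$ write $C(rt)\in W^*$ for the contraction of the symmetric trilinear form $C$ with $r$ and $t$. Then there are a nondegenerate invariant symmetric bilinear form $K$ on $\mathfrak l$ and a bilinear map $\theta:W\times W^*\to\mathfrak l$, dual to the action of $\mathfrak l$ on $W$ in the sense that $K(x,\theta(u,u^*))=\langle x\cdot u,u^*\rangle$ for all $x\in\mathfrak l$, $u\in W$, $u^*\in W^*$, such that $\mathfrak g=\mathfrak l\oplus W\oplus W^*$ is a simple Lie algebra for the bracket which extends that of $\mathfrak l$ and the natural actions of $\mathfrak l$ on $W$ and $W^*$ and satisfies $[W,W]=[W^*,W^*]=0$ and $[u,u^*]=\theta(u,u^*)$.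 Furthermore there is a nonzero $\mathfrak h$-invariant cubic form $C^*\in S^3W$ on $W^*$ such that $V=\mathbb C\oplus W\oplus W^*\oplus\mathbb C$ is a simple $\mathfrak g$-module for the following action on $(\alpha,r,s^*,\beta^*)\in V$: each $x\in\mathfrak h$ acts by $$x\cdot(\alpha,r,s^*,\beta^*)=(0,\;x\cdot r,\;x\cdot s^*,\;0);$$ the element $\mathbf 1$ of the center of $\mathfrak l$ that acts on $W$ as the identity acts on the four summands of $V$ by the scalars $-\tfrac32,-\tfrac12,\tfrac12,\tfrac32$; and, for $t\in W$ and $t^*\in W^*$, $$t\cdot(\alpha,r,s^*,\beta^*)=\bigl(0,\;3\alpha t,\;C(rt),\;\tfrac12\langle t,s^*\rangle\bigr),$$ $$t^*\cdot(\alpha,r,s^*,\beta^*)=\bigl(\tfrac12\langle r,t^*\rangle,\;C^*(s^*t^*),\;3\beta^*t^*,\;0\bigr).$$ -/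

import Mathlib

open scoped TensorProduct

noncomputable section

section Squares

variable (R L M : Type*) [CommRing R] [LieRing L] [LieAlgebra R L]
  [AddCommGroup M] [Module R M] [LieRingModule L M] [LieModule R L M]

theorem tensorSwap_lie (x : L) (t : M ⊗[R] M) :
    TensorProduct.comm R M M ⁅x, t⁆ = ⁅x, TensorProduct.comm R M M t⁆ := by
  induction t using TensorProduct.induction_on with
  | zero => simp
  | tmul a b => simp [add_comm]
  | add a b ha hb => simp [ha, hb]

/-- The symmetric square of a Lie module, realised (in characteristic zero) as the submodule of
symmetric tensors in `M ⊗ M`. -/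
def symSquare : LieSubmodule R L (M ⊗[R] M) where
  carrier := {t | TensorProduct.comm R M M t = t}
  add_mem' ha hb := by
    simp only [Set.mem_ofPred_eq] at ha hb ⊢
    rw [map_add, ha, hb]
  zero_mem' := map_zero _
  smul_mem' c t ht := by
    simp only [Set.mem_ofPred_eq] at ht ⊢
    rw [map_smul, ht]
  lie_mem {x t} ht := by
    change TensorProduct.comm R M M ⁅x, t⁆ = ⁅x, t⁆
    have ht' : TensorProduct.comm R M M t = t := ht
    rw [tensorSwap_lie, ht']

/-- The exterior square of a Lie module, realised (in characteristic zero) as the submodule of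
antisymmetric tensors in `M ⊗ M`. -/
def altSquare : LieSubmodule R L (M ⊗[R] M) where
  carrier := {t | TensorProduct.comm R M M t = -t}
  add_mem' ha hb := by
    simp only [Set.mem_ofPred_eq] at ha hb ⊢
    rw [map_add, ha, hb, neg_add]
  zero_mem' := by simp
  smul_mem' c t ht := by
    simp only [Set.mem_ofPred_eq] at ht ⊢
    rw [map_smul, ht, smul_neg]
  lie_mem {x t} ht := by
    change TensorProduct.comm R M M ⁅x, t⁆ = -⁅x, t⁆
    have ht' : TensorProduct.comm R M M t = -t := ht
    rw [tensorSwap_lie, ht', lie_neg]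

end Squares

/-- The derived ideal `[L, L]`; for a reductive Lie algebra, its semisimple part. -/
abbrev derivedIdeal (L : Type*) [LieRing L] [LieAlgebra ℂ L] : LieIdeal ℂ L :=
  ⁅(⊤ : LieIdeal ℂ L), (⊤ : LieIdeal ℂ L)⁆

/-- A cubic form on `M`, given by its polarisation: a symmetric trilinear form. -/
structure CubicForm (M : Type*) [AddCommGroup M] [Module ℂ M] where
  toFun : M →ₗ[ℂ] M →ₗ[ℂ] M →ₗ[ℂ] ℂ
  symm_left : ∀ u v w, toFun u v w = toFun v u w
  symm_right : ∀ u v w, toFun u v w = toFun u w v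

/-- Invariance of a cubic form under the action of a Lie algebra. -/
def CubicForm.IsInvariant {M : Type*} [AddCommGroup M] [Module ℂ M] (C : CubicForm M)
    (L : Type*) [LieRing L] [LieAlgebra ℂ L] [LieRingModule L M] : Prop :=
  ∀ (x : L) (u v w : M),
    C.toFun ⁅x, u⁆ v w + C.toFun u ⁅x, v⁆ w + C.toFun u v ⁅x, w⁆ = 0

section Graded

variable {L W : Type*} [LieRing L] [LieAlgebra ℂ L]
  [AddCommGroup W] [Module ℂ W] [LieRingModule L W] [LieModule ℂ L W]

/-- The conditions on a bilinear map `θ : W × W* → L` under which `L ⊕ W ⊕ W*` is a Lie algebra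
for the bracket extending that of `L` and the actions of `L` on `W` and `W*`, with `W` and `W*`
abelian and `[u, f] = θ(u, f)` for `u ∈ W`, `f ∈ W*`. -/
structure IsLiePairing (θ : W →ₗ[ℂ] Module.Dual ℂ W →ₗ[ℂ] L) : Prop where
  equivariant : ∀ (x : L) (u : W) (f : Module.Dual ℂ W),
    ⁅x, θ u f⁆ = θ ⁅x, u⁆ f + θ u ⁅x, f⁆
  symm_left : ∀ (u v : W) (f : Module.Dual ℂ W), ⁅θ u f, v⁆ = ⁅θ v f, u⁆
  symm_right : ∀ (u : W) (f g : Module.Dual ℂ W), ⁅θ u f, g⁆ = ⁅θ u g, f⁆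

/-- The underlying vector space `L ⊕ W ⊕ W*` of the graded Lie algebra defined by `θ`. -/
def GradedLie (θ : W →ₗ[ℂ] Module.Dual ℂ W →ₗ[ℂ] L) (_ : IsLiePairing θ) : Type _ :=
  L × W × Module.Dual ℂ W

namespace GradedLie

variable (θ : W →ₗ[ℂ] Module.Dual ℂ W →ₗ[ℂ] L) (hθ : IsLiePairing θ)

instance : AddCommGroup (GradedLie θ hθ) :=
  inferInstanceAs (AddCommGroup (L × W × Module.Dual ℂ W))

instance : Module ℂ (GradedLie θ hθ) :=
  inferInstanceAs (Module ℂ (L × W × Module.Dual ℂ W))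

instance : LieRing (GradedLie θ hθ) where
  bracket a b :=
    (⁅a.1, b.1⁆ + θ a.2.1 b.2.2 - θ b.2.1 a.2.2,
      ⁅a.1, b.2.1⁆ - ⁅b.1, a.2.1⁆, ⁅a.1, b.2.2⁆ - ⁅b.1, a.2.2⁆)
  add_lie a b c := by
    refine Prod.ext ?_ (Prod.ext ?_ ?_)
    · change ⁅a.1 + b.1, c.1⁆ + θ (a.2.1 + b.2.1) c.2.2 - θ c.2.1 (a.2.2 + b.2.2)
        = ⁅a.1, c.1⁆ + θ a.2.1 c.2.2 - θ c.2.1 a.2.2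
          + (⁅b.1, c.1⁆ + θ b.2.1 c.2.2 - θ c.2.1 b.2.2)
      simp only [add_lie, map_add, LinearMap.add_apply]
      abel
    · change ⁅a.1 + b.1, c.2.1⁆ - ⁅c.1, a.2.1 + b.2.1⁆
        = ⁅a.1, c.2.1⁆ - ⁅c.1, a.2.1⁆ + (⁅b.1, c.2.1⁆ - ⁅c.1, b.2.1⁆)
      simp only [add_lie, lie_add]
      abel
    · change ⁅a.1 + b.1, c.2.2⁆ - ⁅c.1, a.2.2 + b.2.2⁆
        = ⁅a.1, c.2.2⁆ - ⁅c.1, a.2.2⁆ + (⁅b.1, c.2.2⁆ - ⁅c.1, b.2.2⁆)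
      simp only [add_lie, lie_add]
      abel
  lie_add a b c := by
    refine Prod.ext ?_ (Prod.ext ?_ ?_)
    · change ⁅a.1, b.1 + c.1⁆ + θ a.2.1 (b.2.2 + c.2.2) - θ (b.2.1 + c.2.1) a.2.2
        = ⁅a.1, b.1⁆ + θ a.2.1 b.2.2 - θ b.2.1 a.2.2
          + (⁅a.1, c.1⁆ + θ a.2.1 c.2.2 - θ c.2.1 a.2.2)
      simp only [lie_add, map_add, LinearMap.add_apply]
      abel
    · change ⁅a.1, b.2.1 + c.2.1⁆ - ⁅b.1 + c.1, a.2.1⁆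
        = ⁅a.1, b.2.1⁆ - ⁅b.1, a.2.1⁆ + (⁅a.1, c.2.1⁆ - ⁅c.1, a.2.1⁆)
      simp only [add_lie, lie_add]
      abel
    · change ⁅a.1, b.2.2 + c.2.2⁆ - ⁅b.1 + c.1, a.2.2⁆
        = ⁅a.1, b.2.2⁆ - ⁅b.1, a.2.2⁆ + (⁅a.1, c.2.2⁆ - ⁅c.1, a.2.2⁆)
      simp only [add_lie, lie_add]
      abel
  lie_self a := by
    refine Prod.ext ?_ (Prod.ext ?_ ?_)
    · change ⁅a.1, a.1⁆ + θ a.2.1 a.2.2 - θ a.2.1 a.2.2 = 0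
      simp
    · change ⁅a.1, a.2.1⁆ - ⁅a.1, a.2.1⁆ = 0
      simp
    · change ⁅a.1, a.2.2⁆ - ⁅a.1, a.2.2⁆ = 0
      simp
  leibniz_lie a b c := by
    obtain ⟨x, u, f⟩ := a
    obtain ⟨y, v, g⟩ := b
    obtain ⟨z, w, h⟩ := c
    refine Prod.ext ?_ (Prod.ext ?_ ?_)
    · change ⁅x, ⁅y, z⁆ + θ v h - θ w g⁆ + θ u (⁅y, h⁆ - ⁅z, g⁆) - θ (⁅y, w⁆ - ⁅z, v⁆) f
        = ⁅⁅x, y⁆ + θ u g - θ v f, z⁆ + θ (⁅x, v⁆ - ⁅y, u⁆) h - θ w (⁅x, g⁆ - ⁅y, f⁆)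
          + (⁅y, ⁅x, z⁆ + θ u h - θ w f⁆ + θ v (⁅x, h⁆ - ⁅z, f⁆) - θ (⁅x, w⁆ - ⁅z, u⁆) g)
      rw [← lie_skew (⁅x, y⁆ + θ u g - θ v f) z]
      simp only [lie_add, lie_sub, map_sub, LinearMap.sub_apply, hθ.equivariant]
      rw [leibniz_lie x y z, ← lie_skew ⁅x, y⁆ z]
      abel
    · change ⁅x, ⁅y, w⁆ - ⁅z, v⁆⁆ - ⁅⁅y, z⁆ + θ v h - θ w g, u⁆
        = ⁅⁅x, y⁆ + θ u g - θ v f, w⁆ - ⁅z, ⁅x, v⁆ - ⁅y, u⁆⁆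
          + (⁅y, ⁅x, w⁆ - ⁅z, u⁆⁆ - ⁅⁅x, z⁆ + θ u h - θ w f, v⁆)
      simp only [lie_sub, add_lie, sub_lie, lie_lie]
      rw [hθ.symm_left v u h, hθ.symm_left w u g, hθ.symm_left w v f]
      abel
    · change ⁅x, ⁅y, h⁆ - ⁅z, g⁆⁆ - ⁅⁅y, z⁆ + θ v h - θ w g, f⁆
        = ⁅⁅x, y⁆ + θ u g - θ v f, h⁆ - ⁅z, ⁅x, g⁆ - ⁅y, f⁆⁆
          + (⁅y, ⁅x, h⁆ - ⁅z, f⁆⁆ - ⁅⁅x, z⁆ + θ u h - θ w f, g⁆)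
      simp only [lie_sub, add_lie, sub_lie, lie_lie]
      rw [hθ.symm_right v h f, hθ.symm_right w g f, hθ.symm_right u h g]
      abel

instance : LieAlgebra ℂ (GradedLie θ hθ) where
  lie_smul r a b := by
    refine Prod.ext ?_ (Prod.ext ?_ ?_)
    · change ⁅a.1, r • b.1⁆ + θ a.2.1 (r • b.2.2) - θ (r • b.2.1) a.2.2
        = r • (⁅a.1, b.1⁆ + θ a.2.1 b.2.2 - θ b.2.1 a.2.2)
      simp only [lie_smul, map_smul, LinearMap.smul_apply, smul_sub, smul_add]
    · change ⁅a.1, r • b.2.1⁆ - ⁅r • b.1, a.2.1⁆ = r • (⁅a.1, b.2.1⁆ - ⁅b.1, a.2.1⁆)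
      simp only [lie_smul, smul_lie, smul_sub]
    · change ⁅a.1, r • b.2.2⁆ - ⁅r • b.1, a.2.2⁆ = r • (⁅a.1, b.2.2⁆ - ⁅b.1, a.2.2⁆)
      simp only [lie_smul, smul_lie, smul_sub]

/-- The element `x ⊕ u ⊕ f` of the graded Lie algebra. -/
def mk (x : L) (u : W) (f : Module.Dual ℂ W) : GradedLie θ hθ := (x, u, f)

end GradedLie

/-- The assertion that a `g`-module structure on `V = ℂ ⊕ W ⊕ W* ⊕ ℂ`, where `g = L ⊕ W ⊕ W*`, is
given by the explicit formulas attached to a cubic form `C` on `W` and a cubic form `C'` on `W*`.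
Here `C(t r) ∈ W*` is `C.toFun t r`, and `C'(f s) ∈ W** = W` is obtained from `C'.toFun f s`. -/
structure IsCubicAction [Module.Finite ℂ W]
    (θ : W →ₗ[ℂ] Module.Dual ℂ W →ₗ[ℂ] L) (hθ : IsLiePairing θ)
    (C : CubicForm W) (C' : CubicForm (Module.Dual ℂ W))
    [LieRingModule (GradedLie θ hθ) (ℂ × W × Module.Dual ℂ W × ℂ)] : Prop where
  /-- `[L, L]` acts naturally on `W` and `W*`, and trivially on the two lines. -/
  derived_act : ∀ x ∈ derivedIdeal L, ∀ (a : ℂ) (r : W) (s : Module.Dual ℂ W) (b : ℂ),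
    ⁅GradedLie.mk θ hθ x 0 0, (a, r, s, b)⁆ = ((0 : ℂ), ⁅x, r⁆, ⁅x, s⁆, (0 : ℂ))
  /-- The central element acting on `W ⊂ g` as the identity acts on `V` by the scalars
  `-3/2, -1/2, 1/2, 3/2`. -/
  center_act : ∃ z ∈ LieAlgebra.center ℂ L, (∀ w : W, ⁅z, w⁆ = w) ∧
    ∀ (a : ℂ) (r : W) (s : Module.Dual ℂ W) (b : ℂ),
      ⁅GradedLie.mk θ hθ z 0 0, (a, r, s, b)⁆
        = (-(3 / 2 : ℂ) * a, -(1 / 2 : ℂ) • r, (1 / 2 : ℂ) • s, (3 / 2 : ℂ) * b)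
  raise_act : ∀ (t : W) (a : ℂ) (r : W) (s : Module.Dual ℂ W) (b : ℂ),
    ⁅GradedLie.mk θ hθ 0 t 0, (a, r, s, b)⁆
      = ((0 : ℂ), (3 * a) • t, C.toFun t r, (1 / 2 : ℂ) * s t)
  lower_act : ∀ (f : Module.Dual ℂ W) (a : ℂ) (r : W) (s : Module.Dual ℂ W) (b : ℂ),
    ⁅GradedLie.mk θ hθ 0 0 f, (a, r, s, b)⁆
      = ((1 / 2 : ℂ) * f r, (Module.evalEquiv ℂ W).symm (C'.toFun f s), (3 * b) • f, (0 : ℂ))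

end Graded

end

noncomputable section

/-! Everything is read off the split Casimir operator `T = ∑ bᵢ ⊗ b'ᵢ` on `W ⊗ W`, formed from dual
families for a well-chosen invariant form `K`. Write `n = dim W`, let `z` be the central element
acting as the identity, and put `ζ = K(z, ·)`. On `[L, L]` the form `K` is a multiple of the trace
form of `W`; it is normalised by `K(z, z) = 1` and by the Casimir element acting on `W` as `n`.

Jacobi identity. With this normalisation `T` and its composite with the swap both have trace `n²`,
so `T` has trace zero on `Λ²W`. By Schur it vanishes there. Since `g(θ(u, f)·v) = (f ⊗ g)(T(u ⊗
v))`, this vanishing is the Jacobi identity for two vectors of `W` and one of `W*`, and, by symmetry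
of `∑ bᵢ ⊗ b'ᵢ`, for one of `W` and two of `W*`.

The dual cubic form. The Casimir acts on `W ⊗ W` as `2n + 2T`. On `P`, a copy of `W*` twisted by the
character `3ζ`, it acts as `n + 3`, so `T = (3 - n)/2`; a trace count on `S²W` then forces `T = 3`
on `S`. Hence `T = 3 - ((n + 3)/2) π` on `S²W`, with `π` the projection to `P`. As the eigenvalues
differ, contraction with `C` kills `S`, so it identifies `P` with `W*`. The inclusion `W* → P` is a
trilinear form on `W*`; comparing it with its symmetrisation through contraction with `C` shows that
it is already symmetric. A suitable multiple `C'` expresses `T` through `C' ∘ C`, and that identity,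
with equivariance, gives the module axioms on `V`.

Simplicity of `g` and of `V` follows from the gradings by `z`. -/

/-- Schur's lemma: an endomorphism of a finite-dimensional irreducible complex Lie module that
commutes with the action is a scalar. -/
theorem LieModule.exists_eq_smul_of_commute {L M : Type*} [LieRing L] [LieAlgebra ℂ L]
    [AddCommGroup M] [Module ℂ M] [Module.Finite ℂ M] [LieRingModule L M] [LieModule ℂ L M]
    (hirr : LieModule.IsIrreducible ℂ L M) (f : M →ₗ[ℂ] M)
    (hf : ∀ (x : L) (m : M), f ⁅x, m⁆ = ⁅x, f m⁆) : ∃ c : ℂ, ∀ m, f m = c • m := by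
  have : Nontrivial M := LieModule.nontrivial_of_isIrreducible ℂ L M
  obtain ⟨c, hc⟩ := Module.End.exists_eigenvalue f
  obtain ⟨v, hv⟩ := hc.exists_hasEigenvector
  let N : LieSubmodule ℂ L M :=
    { Module.End.eigenspace f c with
      lie_mem := by
        intro x m hm
        have hm' : f m = c • m := Module.End.mem_eigenspace_iff.mp hm
        refine Module.End.mem_eigenspace_iff.mpr ?_
        rw [hf, hm', lie_smul] }
  have hN : N = ⊤ := by
    refine (hirr.eq_bot_or_eq_top N).resolve_left fun h => hv.2 ?_
    have : v ∈ N := hv.1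
    rwa [h, LieSubmodule.mem_bot] at this
  refine ⟨c, fun m => Module.End.mem_eigenspace_iff.mp ?_⟩
  have : m ∈ N := hN ▸ LieSubmodule.mem_top m
  exact this

/-! ### Trace form and center of a faithful irreducible module -/

section Reductive

variable {L W : Type*} [LieRing L] [LieAlgebra ℂ L] [Module.Finite ℂ L]
  [AddCommGroup W] [Module ℂ W] [Module.Finite ℂ W] [LieRingModule L W] [LieModule ℂ L W]

/-- The trace form of a faithful irreducible module is non-degenerate. -/
theorem LieModule.eq_zero_of_forall_traceForm_eq_zero
    (hirr : LieModule.IsIrreducible ℂ L W) (hfaith : LieModule.IsFaithful ℂ L W)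
    (x : L) (hx : ∀ y, LieModule.traceForm ℂ L W x y = 0) : x = 0 := by
  have hW : Nontrivial W := LieModule.nontrivial_of_isIrreducible ℂ L W
  let N : LieIdeal ℂ L :=
    { LinearMap.ker (LieModule.traceForm ℂ L W) with
      lie_mem := by
        intro u v hv
        have hv' : LieModule.traceForm ℂ L W v = 0 := hv
        change LieModule.traceForm ℂ L W ⁅u, v⁆ = 0
        ext w
        rw [LieModule.traceForm_apply_lie_apply', hv']
        simp }
  have hN : ∀ {v : L}, v ∈ N → ∀ y, LieModule.traceForm ℂ L W v y = 0 := fun {v} hv y => by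
    have hv' : LieModule.traceForm ℂ L W v = 0 := hv
    rw [hv', LinearMap.zero_apply]
  -- The form vanishes on its radical `N`, so `[N, N]` acts nilpotently on `W` (Cartan's criterion).
  -- Faithfulness turns this into ad-nilpotency, so `N` is solvable and lies in the radical of `L`.
  have htr : LieModule.traceForm ℂ N W = 0 := by
    ext u v
    exact hN u.2 v
  have hnil := LieModule.isNilpotent_derivedSeries_of_traceForm_eq_zero htr
  have hsol : LieAlgebra.IsSolvable N := by
    let _ : LieRing (Module.End ℂ W) := LieRing.ofAssociativeRing
    have hDnil : LieRing.IsNilpotent (LieAlgebra.derivedSeries ℂ N 1) := by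
      rw [LieAlgebra.isNilpotent_iff_forall (R := ℂ)]
      intro u
      have hu : _root_.IsNilpotent (LieModule.toEnd ℂ L W (u : N)) :=
        (LieModule.isNilpotent_iff_forall' (R := ℂ)).mp hnil u
      obtain ⟨k, hk⟩ := LieAlgebra.ad_nilpotent_of_nilpotent (R := ℂ) hu
      refine ⟨k, LinearMap.ext fun w => ?_⟩
      have key : ∀ j, LieModule.toEnd ℂ L W
          (((((LieAlgebra.ad ℂ (LieAlgebra.derivedSeries ℂ N 1) u) ^ j) w :
            LieAlgebra.derivedSeries ℂ N 1) : N) : L)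
          = ((LieAlgebra.ad ℂ (Module.End ℂ W) (LieModule.toEnd ℂ L W (u : N))) ^ j)
            (LieModule.toEnd ℂ L W ((w : N) : L)) := by
        intro j
        induction j with
        | zero => simp
        | succ j ih =>
          rw [pow_succ', pow_succ', Module.End.mul_apply, Module.End.mul_apply, ← ih]
          simp
      have h0 := key k
      rw [hk, LinearMap.zero_apply, LieModule.toEnd_eq_zero_iff] at h0
      exact Subtype.ext (Subtype.ext h0)
    obtain ⟨k, hk⟩ := LieAlgebra.IsSolvable.solvable ℂ (LieAlgebra.derivedSeries ℂ N 1)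
    refine LieAlgebra.IsSolvable.mk (R := ℂ) (k := k + 1) ?_
    rw [LieIdeal.derivedSeries_eq_bot_iff] at hk
    rw [LieAlgebra.derivedSeries_def, LieAlgebra.derivedSeriesOfIdeal_add]
    exact hk
  have hrad : x ∈ LieAlgebra.radical ℂ L :=
    (LieAlgebra.LieIdeal.solvable_iff_le_radical ℂ L N).mp hsol (LinearMap.ext hx)
  obtain ⟨hc, hcen⟩ := LieAlgebra.hasCentralRadical_and_of_isIrreducible_of_isFaithful ℂ L W
  -- A radical element acts as a scalar `c`, and pairs with itself to `c² dim W`.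
  rw [hc.radical_eq_center, hcen, Submodule.mem_span_singleton] at hrad
  obtain ⟨c, hc⟩ := hrad
  have h0 := hx x
  rw [LieModule.traceForm_apply_apply, ← hc] at h0
  have hn : (Module.finrank ℂ W : ℂ) ≠ 0 := Nat.cast_ne_zero.mpr Module.finrank_pos.ne'
  have hc0 : c = 0 := by
    simpa [LinearMap.smul_comp, LinearMap.comp_smul, hn] using h0
  rw [← LieModule.toEnd_eq_zero_iff ℂ L W, ← hc, hc0, zero_smul]

omit [Module.Finite ℂ L] in
theorem LieModule.exists_mem_center_lie_eq_self
    (hirr : LieModule.IsIrreducible ℂ L W)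
    (hnontriv : ∃ z ∈ LieAlgebra.center ℂ L, ∃ w : W, ⁅z, w⁆ ≠ 0) :
    ∃ z ∈ LieAlgebra.center ℂ L, ∀ w : W, ⁅z, w⁆ = w := by
  obtain ⟨z, hz, w, hw⟩ := hnontriv
  obtain ⟨c, hc⟩ := LieModule.exists_eq_smul_of_commute hirr (LieModule.toEnd ℂ L W z) (by
    intro x m
    have : ⁅x, z⁆ = 0 := (LieModule.mem_maxTrivSubmodule ℂ L L z).mp hz x
    have h2 := leibniz_lie x z m
    rw [this, zero_lie, zero_add] at h2
    simpa using h2.symm)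
  have hc' : ∀ m : W, ⁅z, m⁆ = c • m := hc
  have hc0 : c ≠ 0 := by
    rintro rfl
    exact hw (by rw [hc', zero_smul])
  refine ⟨c⁻¹ • z, (LieAlgebra.center ℂ L).smul_mem _ hz, fun m => ?_⟩
  rw [smul_lie, hc', inv_smul_smul₀ hc0]

end Reductive

/-! ### The normalised invariant form -/

section Form

variable {L W : Type*} [LieRing L] [LieAlgebra ℂ L] [Module.Finite ℂ L]
  [AddCommGroup W] [Module ℂ W] [Module.Finite ℂ W] [LieRingModule L W] [LieModule ℂ L W]

/-- Needed to solve `κ n (n - 1) = dim L - 1` with `κ ≠ 0`: the two sides vanish together. If `L`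
equals its center it acts by scalars, and every line of `W` is a submodule. -/
theorem LieModule.finrank_eq_one_iff_of_finrank_center_eq_one
    (hcenter : Module.finrank ℂ (LieAlgebra.center ℂ L) = 1)
    (hirr : LieModule.IsIrreducible ℂ L W) (hfaith : LieModule.IsFaithful ℂ L W) :
    Module.finrank ℂ W = 1 ↔ Module.finrank ℂ L = 1 := by
  constructor
  · intro h
    have h1 : Module.finrank ℂ L ≤ Module.finrank ℂ (Module.End ℂ W) :=
      LinearMap.finrank_le_finrank_of_injective (f := (LieModule.toEnd ℂ L W : L →ₗ[ℂ] _))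
        hfaith.injective_toEnd
    have h2 : Module.finrank ℂ (Module.End ℂ W) = 1 := by
      rw [Module.finrank_linearMap, h]
    have h3 := Submodule.finrank_le (LieAlgebra.center ℂ L).toSubmodule
    have h4 : Module.finrank ℂ (LieAlgebra.center ℂ L).toSubmodule = 1 := hcenter
    lia
  · intro h
    have htop : (LieAlgebra.center ℂ L).toSubmodule = ⊤ :=
      Submodule.eq_top_of_finrank_eq (hcenter.trans h.symm)
    obtain ⟨-, hcen⟩ := LieAlgebra.hasCentralRadical_and_of_isIrreducible_of_isFaithful ℂ L W
    have hW : Nontrivial W := LieModule.nontrivial_of_isIrreducible ℂ L W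
    obtain ⟨w, hw⟩ := exists_ne (0 : W)
    let N : LieSubmodule ℂ L W :=
      { Submodule.span ℂ {w} with
        lie_mem := by
          intro x m hm
          have hx : x ∈ LieAlgebra.center ℂ L := by
            have : x ∈ (LieAlgebra.center ℂ L).toSubmodule := htop ▸ Submodule.mem_top
            exact this
          obtain ⟨c, hc⟩ := Submodule.mem_span_singleton.mp ((hcen x).mp hx)
          have hxm : ⁅x, m⁆ = c • m := by
            rw [← LieModule.toEnd_apply_apply ℂ, ← hc]; rfl
          rw [hxm]
          exact (Submodule.span ℂ {w}).smul_mem c hm }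
    have hN : N = ⊤ := by
      refine (hirr.eq_bot_or_eq_top N).resolve_left fun h => hw ?_
      have : w ∈ N := Submodule.mem_span_singleton_self w
      rwa [h, LieSubmodule.mem_bot] at this
    have hspan : Submodule.span ℂ {w} = ⊤ := congrArg LieSubmodule.toSubmodule hN
    rw [← finrank_top ℂ W, ← hspan, finrank_span_singleton hw]

variable (W) in
/-- A non-degenerate invariant symmetric form `K` on a reductive Lie algebra `L`, together with a
central element `z` acting as the identity on `W` and the form `ζ = K(z, ·)`, proportional on
`[L, L]` to the trace form of `W` in such a way that the Casimir element of `K` acts on `W` as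
`dim W`. -/
structure IsNormalizedForm (K : LinearMap.BilinForm ℂ L) (ζ : L →ₗ[ℂ] ℂ) (z : L) : Prop where
  symm : K.IsSymm
  nondegenerate : K.Nondegenerate
  invariant : ∀ x y w : L, K ⁅x, y⁆ w = K x ⁅y, w⁆
  mem_center : z ∈ LieAlgebra.center ℂ L
  lie_self : ∀ w : W, ⁅z, w⁆ = w
  apply_center : ∀ x, K x z = ζ x
  map_center : ζ z = 1
  map_lie : ∀ x y : L, ζ ⁅x, y⁆ = 0
  mem_derived : ∀ x, ζ x = 0 → x ∈ derivedIdeal L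
  trace_eq : ∀ x, LinearMap.trace ℂ W (LieModule.toEnd ℂ L W x) = Module.finrank ℂ W * ζ x
  exists_scale : ∃ κ : ℂ, κ ≠ 0 ∧
    κ * (Module.finrank ℂ W * (Module.finrank ℂ W - 1)) = Module.finrank ℂ L - 1 ∧
    ∀ x y, κ * LieModule.traceForm ℂ L W x y
      = K x y - (1 - κ * Module.finrank ℂ W) * (ζ x * ζ y)

/-- Take `ζ = tr / n` and `K = κ B + (1 - κ n) ζ ⊗ ζ`, with `B` the trace form. The first term sets
the scale on `[L, L]`; the second changes only the central direction and makes `K(z, z) = 1`, since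
`B(z, z) = n`. -/
theorem exists_isNormalizedForm
    (hcenter : Module.finrank ℂ (LieAlgebra.center ℂ L) = 1)
    (hirr : LieModule.IsIrreducible ℂ L W) (hfaith : LieModule.IsFaithful ℂ L W)
    (hnontriv : ∃ z ∈ LieAlgebra.center ℂ L, ∃ w : W, ⁅z, w⁆ ≠ 0) :
    ∃ (K : LinearMap.BilinForm ℂ L) (ζ : L →ₗ[ℂ] ℂ) (z : L), IsNormalizedForm W K ζ z := by
  have hW : Nontrivial W := LieModule.nontrivial_of_isIrreducible ℂ L W
  obtain ⟨z, hz, hzW⟩ := LieModule.exists_mem_center_lie_eq_self hirr hnontriv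
  set n : ℂ := ((Module.finrank ℂ W : ℕ) : ℂ) with hn
  have hn0 : n ≠ 0 := Nat.cast_ne_zero.mpr Module.finrank_pos.ne'
  obtain ⟨κ, hκ, hκn⟩ : ∃ κ : ℂ, κ ≠ 0 ∧ κ * (n * (n - 1)) = Module.finrank ℂ L - 1 := by
    have hiff := LieModule.finrank_eq_one_iff_of_finrank_center_eq_one hcenter hirr hfaith
    by_cases h : Module.finrank ℂ W = 1
    -- When `n = 1` both sides are zero and any nonzero `κ` would do.
    · exact ⟨1, one_ne_zero, by simp [hn, h, hiff.mp h]⟩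
    · have h1 : n - 1 ≠ 0 := sub_ne_zero.mpr (by rw [hn]; exact_mod_cast h)
      have h2 : (Module.finrank ℂ L : ℂ) - 1 ≠ 0 :=
        sub_ne_zero.mpr (by exact_mod_cast fun h' => h (hiff.mpr h'))
      exact ⟨(Module.finrank ℂ L - 1) / (n * (n - 1)), div_ne_zero h2 (mul_ne_zero hn0 h1),
        div_mul_cancel₀ _ (mul_ne_zero hn0 h1)⟩
  have hzE : LieModule.toEnd ℂ L W z = LinearMap.id := LinearMap.ext hzW
  let B := LieModule.traceForm ℂ L W
  let ζ : L →ₗ[ℂ] ℂ := n⁻¹ • (LinearMap.trace ℂ W ∘ₗ (LieModule.toEnd ℂ L W : L →ₗ[ℂ] _))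
  have htr : ∀ x, LinearMap.trace ℂ W (LieModule.toEnd ℂ L W x) = n * ζ x := fun x => by
    simp [ζ, hn0]
  have hBz : ∀ x, B x z = n * ζ x := fun x => by
    rw [← htr, LieModule.traceForm_apply_apply, hzE, LinearMap.comp_id]
  have hζz : ζ z = 1 := by
    have := htr z
    rw [hzE, LinearMap.trace_id] at this
    exact mul_left_cancel₀ hn0 (by rw [← this, mul_one])
  have hζlie : ∀ x y : L, ζ ⁅x, y⁆ = 0 := fun x y => by
    have := htr ⁅x, y⁆
    have h0 : LinearMap.trace ℂ W (LieModule.toEnd ℂ L W ⁅x, y⁆) = 0 := by simp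
    rw [h0] at this
    exact (mul_eq_zero.mp this.symm).resolve_left hn0
  let K : LinearMap.BilinForm ℂ L := κ • B + (1 - κ * n) • LinearMap.BilinForm.linMulLin ζ ζ
  have hK : ∀ x y, K x y = κ * B x y + (1 - κ * n) * (ζ x * ζ y) := fun x y => rfl
  have hKz : ∀ x, K x z = ζ x := fun x => by
    rw [hK, hBz, hζz]; ring
  have hKs : ∀ x y, K x y = K y x := fun x y => by
    rw [hK, hK, LieModule.traceForm_comm ℂ L W x y, mul_comm (ζ x)]
  have hKi : ∀ x y w : L, K ⁅x, y⁆ w = K x ⁅y, w⁆ := fun x y w => by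
    rw [hK, hK, LieModule.traceForm_apply_lie_apply, hζlie, hζlie]; ring
  have hsep : ∀ x, (∀ y, K x y = 0) → x = 0 := fun x hx => by
    have hζx : ζ x = 0 := by rw [← hKz, hx]
    refine LieModule.eq_zero_of_forall_traceForm_eq_zero hirr hfaith x fun y => ?_
    have := hx y
    rw [hK, hζx, zero_mul, mul_zero, add_zero] at this
    exact (mul_eq_zero.mp this).resolve_left hκ
  have hsymm : K.IsSymm := ⟨hKs⟩
  have hnd : K.Nondegenerate :=
    ⟨fun x hx => hsep x hx, fun y hy => hsep y fun x => (hKs _ _).trans (hy x)⟩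
  refine ⟨K, ζ, z, hsymm, hnd, hKi, hz, hzW, hKz, hζz, hζlie, fun x hx => ?_, htr,
    κ, hκ, hκn, fun x y => by rw [hK]; ring⟩
  -- Double orthogonality: by invariance anything orthogonal to `[L, L]` is central, hence a
  -- multiple of `z`, and `K(x, z) = ζ x = 0`.
  change x ∈ (derivedIdeal L).toSubmodule
  rw [← LinearMap.BilinForm.orthogonal_orthogonal hnd hsymm.isRefl (derivedIdeal L).toSubmodule,
    LinearMap.BilinForm.mem_orthogonal_iff]
  intro y hy
  rw [LinearMap.BilinForm.mem_orthogonal_iff] at hy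
  have hyc : y ∈ LieAlgebra.center ℂ L := by
    refine (LieModule.mem_maxTrivSubmodule ℂ L L y).mpr fun v => hsep _ fun u => ?_
    rw [hKs, ← hKi]
    exact hy _ (LieSubmodule.lie_mem_lie (LieSubmodule.mem_top u) (LieSubmodule.mem_top v))
  have hz0 : z ≠ 0 := by
    rintro rfl
    simp at hζz
  obtain ⟨c, hc⟩ := (finrank_eq_one_iff_of_nonzero' (⟨z, hz⟩ : LieAlgebra.center ℂ L)
    (by simpa using hz0)).mp hcenter ⟨y, hyc⟩
  have hc' : c • z = y := congrArg Subtype.val hc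
  change K y x = 0
  rw [hKs, ← hc', map_smul, hKz, hx, smul_zero]

end Form

/-! ### Dual families and Casimir operators -/

section Casimir

variable {L : Type*} [LieRing L] [LieAlgebra ℂ L]

/-- Two families in `L` which are dual to each other with respect to the bilinear form `K`. -/
structure IsDualPair {ι : Type*} [Fintype ι] (K : LinearMap.BilinForm ℂ L) (b b' : ι → L) :
    Prop where
  sum_left : ∀ x, ∑ i, K x (b i) • b' i = x
  sum_right : ∀ x, ∑ i, K x (b' i) • b i = x
  sum_apply : ∑ i, K (b i) (b' i) = Module.finrank ℂ L

theorem exists_isDualPair [Module.Finite ℂ L] (K : LinearMap.BilinForm ℂ L) (hs : K.IsSymm)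
    (hn : K.Nondegenerate) :
    ∃ b b' : Fin (Module.finrank ℂ L) → L, IsDualPair K b b' := by
  let b := Module.finBasis ℂ L
  let b' := K.dualBasis hn b
  have hb : ∀ i j, K (b i) (b' j) = if i = j then 1 else 0 :=
    fun i j => LinearMap.BilinForm.apply_dualBasis_right hn hs b i j
  refine ⟨b, b', fun x => ?_, fun x => ?_, ?_⟩
  · conv_rhs => rw [← b'.sum_repr x]
    simp [b', LinearMap.BilinForm.dualBasis_repr_apply]
  · conv_rhs => rw [← b.sum_repr x]
    refine Finset.sum_congr rfl fun i _ => ?_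
    congr 1
    conv_lhs => rw [← b.sum_repr x, map_sum, LinearMap.sum_apply]
    simp [hb]
  · simp [hb]

/-- The action on a Lie module of the Casimir element attached to a pair of dual families. -/
def casimirEnd {ι : Type*} [Fintype ι] (b b' : ι → L) (M : Type*) [AddCommGroup M] [Module ℂ M]
    [LieRingModule L M] [LieModule ℂ L M] : M →ₗ[ℂ] M :=
  ∑ i, LieModule.toEnd ℂ L M (b i) ∘ₗ LieModule.toEnd ℂ L M (b' i)

variable {ι : Type*} [Fintype ι] {K : LinearMap.BilinForm ℂ L} {b b' : ι → L}
  {M : Type*} [AddCommGroup M] [Module ℂ M] [LieRingModule L M] [LieModule ℂ L M]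

theorem casimirEnd_apply (m : M) : casimirEnd b b' M m = ∑ i, ⁅b i, ⁅b' i, m⁆⁆ := by
  simp [casimirEnd]

namespace IsDualPair

/-- Expanding each `bᵢ` over the `b'ⱼ` produces the coefficients `K(bᵢ, bⱼ)`, which are symmetric;
so the tensor `∑ bᵢ ⊗ b'ᵢ` is symmetric. -/
theorem sum_swap {N : Type*} [AddCommGroup N] [Module ℂ N] (h : IsDualPair K b b')
    (hs : K.IsSymm) (β : L →ₗ[ℂ] L →ₗ[ℂ] N) : ∑ i, β (b i) (b' i) = ∑ i, β (b' i) (b i) := by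
  calc ∑ i, β (b i) (b' i) = ∑ i, ∑ j, K (b i) (b j) • β (b' j) (b' i) := by
        refine Finset.sum_congr rfl fun i _ => ?_
        conv_lhs => rw [← h.sum_left (b i)]
        simp [map_sum]
    _ = ∑ j, ∑ i, K (b i) (b j) • β (b' j) (b' i) := Finset.sum_comm
    _ = ∑ j, β (b' j) (b j) := by
        refine Finset.sum_congr rfl fun j _ => ?_
        conv_rhs => rw [← h.sum_left (b j)]
        simp only [map_sum, map_smul, hs.eq]

/-- By invariance of `K`, the matrices of `ad x` in the two dual families are negative transposes of
each other, so `∑ bᵢ ⊗ b'ᵢ` is an invariant tensor. -/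
theorem sum_lie {N : Type*} [AddCommGroup N] [Module ℂ N] (h : IsDualPair K b b')
    (hs : K.IsSymm) (hi : ∀ x y w : L, K ⁅x, y⁆ w = K x ⁅y, w⁆)
    (β : L →ₗ[ℂ] L →ₗ[ℂ] N) (x : L) :
    ∑ i, (β ⁅x, b i⁆ (b' i) + β (b i) ⁅x, b' i⁆) = 0 := by
  have h1 : ∑ i, β ⁅x, b i⁆ (b' i) = ∑ i, ∑ j, K ⁅x, b i⁆ (b' j) • β (b j) (b' i) :=
    Finset.sum_congr rfl fun i _ => by
      conv_lhs => rw [← h.sum_right ⁅x, b i⁆]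
      simp [map_sum]
  have h2 : ∑ i, β (b i) ⁅x, b' i⁆ = ∑ i, ∑ j, K ⁅x, b' i⁆ (b j) • β (b i) (b' j) :=
    Finset.sum_congr rfl fun i _ => by
      conv_lhs => rw [← h.sum_left ⁅x, b' i⁆]
      simp [map_sum]
  rw [Finset.sum_add_distrib, h1, h2, Finset.sum_comm, ← Finset.sum_add_distrib]
  refine Finset.sum_eq_zero fun i _ => ?_
  rw [← Finset.sum_add_distrib]
  refine Finset.sum_eq_zero fun j _ => ?_
  have : K ⁅x, b' i⁆ (b j) = - K ⁅x, b j⁆ (b' i) := by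
    have h3 : K (b' i) ⁅x, b j⁆ = K ⁅x, b j⁆ (b' i) := hs.eq _ _
    rw [← lie_skew, map_neg, LinearMap.neg_apply, hi, h3]
  rw [this, neg_smul, add_neg_cancel]

theorem casimirEnd_lie (h : IsDualPair K b b')
    (hs : K.IsSymm) (hi : ∀ x y w : L, K ⁅x, y⁆ w = K x ⁅y, w⁆) (x : L) (m : M) :
    casimirEnd b b' M ⁅x, m⁆ = ⁅x, casimirEnd b b' M m⁆ := by
  have key := h.sum_lie hs hi
    (LinearMap.mk₂ ℂ (fun u v => ⁅u, ⁅v, m⁆⁆) (by simp) (by simp) (by simp) (by simp)) x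
  simp only [LinearMap.mk₂_apply] at key
  rw [casimirEnd_apply, casimirEnd_apply, lie_sum, ← sub_eq_zero, ← neg_eq_zero, ← key,
    ← Finset.sum_sub_distrib, ← Finset.sum_neg_distrib]
  refine Finset.sum_congr rfl fun i _ => ?_
  rw [leibniz_lie x (b i), leibniz_lie x (b' i), lie_add]
  abel

/-- The two cross terms of the Leibniz rule coincide by symmetry of `∑ bᵢ ⊗ b'ᵢ`, whence the factor
2. -/
theorem casimirEnd_tmul {N : Type*} [AddCommGroup N] [Module ℂ N] [LieRingModule L N]
    [LieModule ℂ L N] (h : IsDualPair K b b') (hs : K.IsSymm) (m : M) (n : N) :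
    casimirEnd b b' (M ⊗[ℂ] N) (m ⊗ₜ n) = casimirEnd b b' M m ⊗ₜ n + m ⊗ₜ casimirEnd b b' N n
      + (2 : ℂ) • ∑ i, ⁅b i, m⁆ ⊗ₜ[ℂ] ⁅b' i, n⁆ := by
  have hsw : ∑ i, ⁅b i, m⁆ ⊗ₜ[ℂ] ⁅b' i, n⁆ = ∑ i, ⁅b' i, m⁆ ⊗ₜ[ℂ] ⁅b i, n⁆ :=
    h.sum_swap hs (LinearMap.mk₂ ℂ (fun u v => ⁅u, m⁆ ⊗ₜ[ℂ] ⁅v, n⁆)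
      (by simp [TensorProduct.add_tmul]) (by simp [TensorProduct.smul_tmul'])
      (by simp [TensorProduct.tmul_add]) (by simp))
  rw [casimirEnd_apply, casimirEnd_apply, casimirEnd_apply, TensorProduct.sum_tmul,
    TensorProduct.tmul_sum, two_smul]
  nth_rewrite 2 [hsw]
  rw [← Finset.sum_add_distrib, ← Finset.sum_add_distrib, ← Finset.sum_add_distrib]
  refine Finset.sum_congr rfl fun i _ => ?_
  simp only [TensorProduct.LieModule.lie_tmul_right, lie_add]
  abel

end IsDualPair

end Casimir

/-! ### A trace identity for the swap -/

section Trace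

variable {W : Type*} [AddCommGroup W] [Module ℂ W] [Module.Finite ℂ W]

/-- Turns the trace of `T` composed with the swap into the trace of the Casimir operator on `W`. -/
theorem LinearMap.trace_map_comp_comm (A B : W →ₗ[ℂ] W) :
    LinearMap.trace ℂ (W ⊗[ℂ] W)
      (TensorProduct.map A B ∘ₗ (TensorProduct.comm ℂ W W).toLinearMap)
      = LinearMap.trace ℂ W (A ∘ₗ B) := by
  let e := Module.finBasis ℂ W
  rw [LinearMap.trace_eq_matrix_trace ℂ (e.tensorProduct e), LinearMap.trace_eq_matrix_trace ℂ e,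
    LinearMap.toMatrix_comp e e e, Matrix.trace, Matrix.trace, Fintype.sum_prod_type]
  refine Finset.sum_congr rfl fun i _ => ?_
  simp [Matrix.mul_apply, LinearMap.toMatrix_apply, mul_comm]

end Trace

/-! ### Eigenvalues of the split Casimir operator -/

section SplitCasimir

variable {L W : Type*} [LieRing L] [LieAlgebra ℂ L]
  [AddCommGroup W] [Module ℂ W] [LieRingModule L W] [LieModule ℂ L W]
  {ι : Type*} [Fintype ι]

variable (W) in
/-- The action on `W ⊗ W` of the split Casimir tensor `∑ bᵢ ⊗ b'ᵢ`. -/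
def splitCasimir (b b' : ι → L) : W ⊗[ℂ] W →ₗ[ℂ] W ⊗[ℂ] W :=
  ∑ i, TensorProduct.map (LieModule.toEnd ℂ L W (b i)) (LieModule.toEnd ℂ L W (b' i))

theorem splitCasimir_tmul (b b' : ι → L) (u v : W) :
    splitCasimir W b b' (u ⊗ₜ v) = ∑ i, ⁅b i, u⁆ ⊗ₜ[ℂ] ⁅b' i, v⁆ := by
  simp [splitCasimir]

variable {K : LinearMap.BilinForm ℂ L} {ζ : L →ₗ[ℂ] ℂ} {z : L} {b b' : ι → L}

theorem splitCasimir_comm (hd : IsDualPair K b b') (hs : K.IsSymm) (t : W ⊗[ℂ] W) :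
    splitCasimir W b b' (TensorProduct.comm ℂ W W t)
      = TensorProduct.comm ℂ W W (splitCasimir W b b' t) := by
  induction t using TensorProduct.induction_on with
  | zero => simp
  | add s t hs ht => simp [hs, ht]
  | tmul u v =>
    have hsw : ∑ i, ⁅b i, v⁆ ⊗ₜ[ℂ] ⁅b' i, u⁆ = ∑ i, ⁅b' i, v⁆ ⊗ₜ[ℂ] ⁅b i, u⁆ :=
      hd.sum_swap hs (LinearMap.mk₂ ℂ (fun x y => ⁅x, v⁆ ⊗ₜ[ℂ] ⁅y, u⁆)
        (by simp [TensorProduct.add_tmul]) (by simp [TensorProduct.smul_tmul'])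
        (by simp [TensorProduct.tmul_add]) (by simp))
    simp [splitCasimir_tmul, hsw]

namespace IsNormalizedForm

variable (hN : IsNormalizedForm W K ζ z) (hd : IsDualPair K b b')
include hN hd

theorem sum_smul : ∑ i, ζ (b i) • b' i = z := by
  rw [← hd.sum_left z]
  exact Finset.sum_congr rfl fun i _ => by rw [← hN.apply_center, hN.symm.eq z]

theorem sum_smul' : ∑ i, ζ (b' i) • b i = z := by
  rw [← hd.sum_right z]
  exact Finset.sum_congr rfl fun i _ => by rw [← hN.apply_center, hN.symm.eq z]

theorem sum_mul : ∑ i, ζ (b i) * ζ (b' i) = 1 := by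
  have := congrArg ζ (hN.sum_smul hd)
  simpa [map_sum, hN.map_center] using this

variable [Module.Finite ℂ W]

/-- Schur gives a scalar, and the trace determines it: `κ tr = ∑ κ B(bᵢ, b'ᵢ) = dim L - (1 - κ n) =
κ n²`, by the equation defining `κ`. -/
theorem casimirEnd_apply_self (hirr : LieModule.IsIrreducible ℂ L W) (w : W) :
    casimirEnd b b' W w = (Module.finrank ℂ W : ℂ) • w := by
  have hW : Nontrivial W := LieModule.nontrivial_of_isIrreducible ℂ L W
  obtain ⟨c, hc⟩ := LieModule.exists_eq_smul_of_commute hirr (casimirEnd b b' W)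
    (hd.casimirEnd_lie hN.symm hN.invariant)
  obtain ⟨κ, hκ, h1, h2⟩ := hN.exists_scale
  set n : ℂ := ((Module.finrank ℂ W : ℕ) : ℂ)
  have hn0 : n ≠ 0 := Nat.cast_ne_zero.mpr Module.finrank_pos.ne'
  have htr : LinearMap.trace ℂ W (casimirEnd b b' W) = c * n := by
    have : casimirEnd b b' W = c • LinearMap.id := LinearMap.ext hc
    rw [this, map_smul, LinearMap.trace_id, smul_eq_mul]
  have htr' : κ * LinearMap.trace ℂ W (casimirEnd b b' W) = κ * (n * n) := by
    have h3 : LinearMap.trace ℂ W (casimirEnd b b' W)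
        = ∑ i, LieModule.traceForm ℂ L W (b i) (b' i) := by
      simp [casimirEnd, LieModule.traceForm_apply_apply]
    rw [h3, Finset.mul_sum, Finset.sum_congr rfl fun i _ => h2 (b i) (b' i),
      Finset.sum_sub_distrib, ← Finset.mul_sum, hN.sum_mul hd, hd.sum_apply]
    linear_combination -h1
  have hcn : c = n := by
    rw [htr] at htr'
    exact mul_right_cancel₀ hn0 (mul_left_cancel₀ hκ htr')
  rw [hc, hcn]

theorem casimirEnd_tensor (hirr : LieModule.IsIrreducible ℂ L W) (t : W ⊗[ℂ] W) :
    casimirEnd b b' (W ⊗[ℂ] W) t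
      = (2 * Module.finrank ℂ W : ℂ) • t + (2 : ℂ) • splitCasimir W b b' t := by
  induction t using TensorProduct.induction_on with
  | zero => simp
  | add s t hs ht => simp only [map_add, hs, ht, smul_add]; abel
  | tmul u v =>
    rw [hd.casimirEnd_tmul hN.symm, hN.casimirEnd_apply_self hd hirr,
      hN.casimirEnd_apply_self hd hirr, splitCasimir_tmul, TensorProduct.tmul_smul,
      ← TensorProduct.smul_tmul', ← two_smul ℂ, smul_smul]

theorem splitCasimir_eq (hirr : LieModule.IsIrreducible ℂ L W) (t : W ⊗[ℂ] W) :
    splitCasimir W b b' t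
      = (1 / 2 : ℂ) • casimirEnd b b' (W ⊗[ℂ] W) t - (Module.finrank ℂ W : ℂ) • t := by
  rw [hN.casimirEnd_tensor hd hirr]
  module

theorem splitCasimir_lie (hirr : LieModule.IsIrreducible ℂ L W) (x : L) (t : W ⊗[ℂ] W) :
    splitCasimir W b b' ⁅x, t⁆ = ⁅x, splitCasimir W b b' t⁆ := by
  rw [hN.splitCasimir_eq hd hirr, hN.splitCasimir_eq hd hirr,
    hd.casimirEnd_lie hN.symm hN.invariant, lie_sub, lie_smul, lie_smul]

/-- The traces of the tensor factors are `n ζ(bᵢ)` and `n ζ(b'ᵢ)`, so only the central direction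
contributes. -/
theorem trace_splitCasimir :
    LinearMap.trace ℂ (W ⊗[ℂ] W) (splitCasimir W b b') = (Module.finrank ℂ W : ℂ) ^ 2 := by
  rw [splitCasimir, map_sum]
  simp only [LinearMap.trace_tensorProduct', hN.trace_eq]
  rw [← mul_one ((Module.finrank ℂ W : ℂ) ^ 2), ← hN.sum_mul hd, Finset.mul_sum]
  exact Finset.sum_congr rfl fun i _ => by ring

theorem trace_splitCasimir_comp_comm (hirr : LieModule.IsIrreducible ℂ L W) :
    LinearMap.trace ℂ (W ⊗[ℂ] W)
      (splitCasimir W b b' ∘ₗ (TensorProduct.comm ℂ W W).toLinearMap)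
      = (Module.finrank ℂ W : ℂ) ^ 2 := by
  have h1 : casimirEnd b b' W = (Module.finrank ℂ W : ℂ) • LinearMap.id :=
    LinearMap.ext (hN.casimirEnd_apply_self hd hirr)
  have h2 : LinearMap.trace ℂ (W ⊗[ℂ] W)
      (splitCasimir W b b' ∘ₗ (TensorProduct.comm ℂ W W).toLinearMap)
      = LinearMap.trace ℂ W (casimirEnd b b' W) := by
    have h3 : splitCasimir W b b' ∘ₗ (TensorProduct.comm ℂ W W).toLinearMap
        = ∑ i, TensorProduct.map (LieModule.toEnd ℂ L W (b i)) (LieModule.toEnd ℂ L W (b' i))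
            ∘ₗ (TensorProduct.comm ℂ W W).toLinearMap :=
      LinearMap.ext fun t => by simp [splitCasimir]
    rw [h3, map_sum, casimirEnd, map_sum]
    exact Finset.sum_congr rfl fun i _ => LinearMap.trace_map_comp_comm _ _
  rw [h2, h1, map_smul, LinearMap.trace_id, smul_eq_mul, sq]

/-- On `Λ²W` the operator is a scalar by Schur, while its trace there is half the difference of two
traces both equal to `n²`. This is the core of the Jacobi identity. -/
theorem splitCasimir_eq_zero_of_mem_altSquare (hirr : LieModule.IsIrreducible ℂ L W)
    (halt : altSquare ℂ L W = ⊥ ∨ LieModule.IsIrreducible ℂ L (altSquare ℂ L W))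
    {t : W ⊗[ℂ] W} (ht : t ∈ altSquare ℂ L W) : splitCasimir W b b' t = 0 := by
  rcases halt with halt | halt
  · rw [halt, LieSubmodule.mem_bot] at ht
    rw [ht, map_zero]
  have hmem : ∀ t ∈ altSquare ℂ L W, splitCasimir W b b' t ∈ altSquare ℂ L W := by
    intro t ht
    have ht' : TensorProduct.comm ℂ W W t = -t := ht
    change TensorProduct.comm ℂ W W _ = -_
    rw [← splitCasimir_comm hd hN.symm, ht', map_neg]
  obtain ⟨c, hc⟩ := LieModule.exists_eq_smul_of_commute halt
    ((splitCasimir W b b').restrict (p := (altSquare ℂ L W).toSubmodule)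
      (q := (altSquare ℂ L W).toSubmodule) hmem)
    (fun x m => Subtype.ext (hN.splitCasimir_lie hd hirr x m))
  have hc' : ∀ t ∈ altSquare ℂ L W, splitCasimir W b b' t = c • t :=
    fun t ht => congrArg Subtype.val (hc ⟨t, ht⟩)
  let σ := (TensorProduct.comm ℂ W W).toLinearMap
  have hσσ : σ ∘ₗ σ = LinearMap.id := LinearMap.ext fun t => by simp [σ]
  let π : W ⊗[ℂ] W →ₗ[ℂ] W ⊗[ℂ] W := (1 / 2 : ℂ) • (LinearMap.id - σ)
  have hπ : ∀ t, π t ∈ altSquare ℂ L W := fun t => by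
    change σ (π t) = - π t
    have : σ (σ t) = t := LinearMap.congr_fun hσσ t
    simp only [π, LinearMap.smul_apply, LinearMap.sub_apply, LinearMap.id_apply, map_smul,
      map_sub, this]
    module
  have hπt : ∀ t ∈ altSquare ℂ L W, π t = t := fun t ht => by
    have ht' : σ t = -t := ht
    simp only [π, LinearMap.smul_apply, LinearMap.sub_apply, LinearMap.id_apply, ht']
    module
  have hTπ : splitCasimir W b b' ∘ₗ π = c • π := LinearMap.ext fun t => hc' _ (hπ t)
  have htr : LinearMap.trace ℂ _ (splitCasimir W b b' ∘ₗ π) = 0 := by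
    have : splitCasimir W b b' ∘ₗ π
        = (1 / 2 : ℂ) • (splitCasimir W b b' - splitCasimir W b b' ∘ₗ σ) := by
      simp only [π, LinearMap.comp_smul, LinearMap.comp_sub, LinearMap.comp_id]
    rw [this, map_smul, map_sub, hN.trace_splitCasimir hd,
      hN.trace_splitCasimir_comp_comm hd hirr, sub_self, smul_zero]
  rw [hTπ, map_smul, smul_eq_mul, mul_eq_zero] at htr
  -- Either the scalar is zero, or the projection to `Λ²W` has trace zero and so vanishes.
  rcases htr with h | h
  · rw [hc' t ht, h, zero_smul]
  · have hidem : IsIdempotentElem π := LinearMap.ext fun t => hπt _ (hπ t)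
    have h0 := (LinearMap.IsIdempotentElem.trace_eq_zero_iff hidem).mp h
    rw [← hπt t ht, h0, LinearMap.zero_apply, map_zero]

theorem casimirEnd_dual (hirr : LieModule.IsIrreducible ℂ L W) (f : Module.Dual ℂ W) :
    casimirEnd b b' (Module.Dual ℂ W) f = (Module.finrank ℂ W : ℂ) • f := by
  ext w
  have hsw : ∑ i, ⁅b i, ⁅b' i, w⁆⁆ = ∑ i, ⁅b' i, ⁅b i, w⁆⁆ :=
    hd.sum_swap hN.symm
      (LinearMap.mk₂ ℂ (fun u v => ⁅u, ⁅v, w⁆⁆) (by simp) (by simp) (by simp) (by simp))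
  have h1 := hN.casimirEnd_apply_self hd hirr w
  rw [casimirEnd_apply, hsw] at h1
  rw [casimirEnd_apply, LinearMap.smul_apply, ← map_smul, ← h1, map_sum, LinearMap.sum_apply]
  simp

/-- This is the Casimir on `W*` twisted by the character `3ζ`: `n` from `W*`, `-3` from each cross
term because `z` acts on `W*` as `-1`, and `9` from the character. The twist reflects that `z` acts
by `2` on `W ⊗ W` and by `-1` on `W*`. -/
theorem sum_twisted_dual (hirr : LieModule.IsIrreducible ℂ L W) (f : Module.Dual ℂ W) :
    ∑ i, (⁅b i, ⁅b' i, f⁆ + (3 * ζ (b' i)) • f⁆ + (3 * ζ (b i)) • (⁅b' i, f⁆ + (3 * ζ (b' i)) • f))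
      = (Module.finrank ℂ W + 3 : ℂ) • f := by
  have hz : ⁅z, f⁆ = -f := by
    ext w
    simp [hN.lie_self]
  have h1 : ∑ i, ζ (b' i) • ⁅b i, f⁆ = -f := by
    rw [← hz, ← hN.sum_smul' hd, sum_lie]
    simp only [smul_lie]
  have h2 : ∑ i, ζ (b i) • ⁅b' i, f⁆ = -f := by
    rw [← hz, ← hN.sum_smul hd, sum_lie]
    simp only [smul_lie]
  have h3 : ∑ i, ⁅b i, ⁅b' i, f⁆⁆ = (Module.finrank ℂ W : ℂ) • f := by
    rw [← casimirEnd_apply, hN.casimirEnd_dual hd hirr]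
  have h4 : ∑ i, (ζ (b i) * ζ (b' i)) • f = f := by
    rw [← Finset.sum_smul, hN.sum_mul hd, one_smul]
  have h5 : ∀ i, (⁅b i, ⁅b' i, f⁆ + (3 * ζ (b' i)) • f⁆
      + (3 * ζ (b i)) • (⁅b' i, f⁆ + (3 * ζ (b' i)) • f))
      = ⁅b i, ⁅b' i, f⁆⁆ + (3 : ℂ) • (ζ (b' i) • ⁅b i, f⁆) + (3 : ℂ) • (ζ (b i) • ⁅b' i, f⁆)
        + (9 : ℂ) • ((ζ (b i) * ζ (b' i)) • f) := fun i => by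
    rw [lie_add, lie_smul]
    module
  simp only [h5, Finset.sum_add_distrib, ← Finset.smul_sum, h1, h2, h3, h4]
  module

/-- A linear map `W ⊗ W → W*` which is equivariant for `[L, L]` intertwines the split Casimir
operator with the scalar `(3 - dim W) / 2`. -/
theorem map_splitCasimir_of_twisted (hirr : LieModule.IsIrreducible ℂ L W)
    (φ : W ⊗[ℂ] W →ₗ[ℂ] Module.Dual ℂ W)
    (hφ : ∀ (x : L) t, φ ⁅x, t⁆ = ⁅x, φ t⁆ + (3 * ζ x) • φ t) (t : W ⊗[ℂ] W) :
    φ (splitCasimir W b b' t) = ((3 - Module.finrank ℂ W) / 2 : ℂ) • φ t := by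
  have h : φ (casimirEnd b b' (W ⊗[ℂ] W) t) = (Module.finrank ℂ W + 3 : ℂ) • φ t := by
    rw [← hN.sum_twisted_dual hd hirr, casimirEnd_apply, map_sum]
    simp only [hφ]
  rw [hN.splitCasimir_eq hd hirr, map_sub, map_smul, h, map_smul]
  module

/-- The split Casimir operator acts by the scalar `(3 - dim W) / 2` on the image of a linear map
`W* → W ⊗ W` which is equivariant for `[L, L]`. -/
theorem splitCasimir_map_of_twisted (hirr : LieModule.IsIrreducible ℂ L W)
    (ψ : Module.Dual ℂ W →ₗ[ℂ] W ⊗[ℂ] W)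
    (hψ : ∀ (x : L) f, ⁅x, ψ f⁆ = ψ (⁅x, f⁆ + (3 * ζ x) • f)) (f : Module.Dual ℂ W) :
    splitCasimir W b b' (ψ f) = ((3 - Module.finrank ℂ W) / 2 : ℂ) • ψ f := by
  have h : casimirEnd b b' (W ⊗[ℂ] W) (ψ f) = (Module.finrank ℂ W + 3 : ℂ) • ψ f := by
    rw [← map_smul, ← hN.sum_twisted_dual hd hirr, casimirEnd_apply, map_sum]
    simp only [hψ]
  rw [hN.splitCasimir_eq hd hirr, h]
  module

end IsNormalizedForm

end SplitCasimir

/-! ### Tensors as bilinear forms, and Schur's lemma on the dual -/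

section TensorBilin

variable (W : Type*) [AddCommGroup W] [Module ℂ W]

/-- A tensor in `W ⊗ W`, seen as a bilinear form on `W*`. -/
def tensorToBilin : W ⊗[ℂ] W →ₗ[ℂ] Module.Dual ℂ W →ₗ[ℂ] Module.Dual ℂ W →ₗ[ℂ] ℂ :=
  TensorProduct.lift (LinearMap.mk₂ ℂ
    (fun u v => LinearMap.BilinForm.linMulLin (Module.Dual.eval ℂ W u) (Module.Dual.eval ℂ W v))
    (fun _ _ _ => by ext; simp [add_mul]) (fun _ _ _ => by ext; simp [mul_assoc])
    (fun _ _ _ => by ext; simp [mul_add]) (fun _ _ _ => by ext; simp [mul_left_comm]))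

variable {W}

@[simp]
theorem tensorToBilin_tmul (u v : W) (f g : Module.Dual ℂ W) :
    tensorToBilin W (u ⊗ₜ v) f g = f u * g v := rfl

theorem tensorToBilin_comm (t : W ⊗[ℂ] W) (f g : Module.Dual ℂ W) :
    tensorToBilin W (TensorProduct.comm ℂ W W t) f g = tensorToBilin W t g f := by
  induction t using TensorProduct.induction_on with
  | zero => simp
  | add s t hs ht => simp [hs, ht]
  | tmul u v => simp [mul_comm]

theorem tensorToBilin_lie {L : Type*} [LieRing L] [LieAlgebra ℂ L] [LieRingModule L W]
    [LieModule ℂ L W] (x : L) (t : W ⊗[ℂ] W) (f g : Module.Dual ℂ W) :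
    tensorToBilin W ⁅x, t⁆ f g = -tensorToBilin W t ⁅x, f⁆ g - tensorToBilin W t f ⁅x, g⁆ := by
  induction t using TensorProduct.induction_on with
  | zero => simp
  | add s t hs ht => simp only [lie_add, map_add, LinearMap.add_apply, hs, ht]; ring
  | tmul u v => simp

theorem tensorToBilin_basis {ι : Type*} [Fintype ι] [DecidableEq ι] (e : Module.Basis ι ℂ W)
    (β : Module.Dual ℂ W →ₗ[ℂ] Module.Dual ℂ W →ₗ[ℂ] ℂ) :
    tensorToBilin W (∑ i, ∑ j, β (e.coord i) (e.coord j) • e i ⊗ₜ e j) = β := by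
  have hf : ∀ f : Module.Dual ℂ W, ∑ i, f (e i) • e.coord i = f := fun f => by
    refine e.ext fun j => ?_
    simp
  ext f g
  conv_rhs => rw [← hf f, ← hf g]
  simp only [map_sum, map_smul, LinearMap.sum_apply, LinearMap.smul_apply, tensorToBilin_tmul,
    smul_eq_mul, Finset.mul_sum]
  rw [Finset.sum_comm]
  exact Finset.sum_congr rfl fun i _ => Finset.sum_congr rfl fun j _ => by ring

variable [Module.Finite ℂ W]

theorem tensorToBilin_bijective : Function.Bijective (tensorToBilin W) := by
  have hsurj : Function.Surjective (tensorToBilin W) :=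
    fun β => ⟨_, tensorToBilin_basis (Module.finBasis ℂ W) β⟩
  have hfin : Module.finrank ℂ (W ⊗[ℂ] W)
      = Module.finrank ℂ (Module.Dual ℂ W →ₗ[ℂ] Module.Dual ℂ W →ₗ[ℂ] ℂ) := by
    simp [Module.finrank_linearMap, Subspace.dual_finrank_eq]
  exact ⟨(LinearMap.injective_iff_surjective_of_finrank_eq_finrank hfin).mpr hsurj, hsurj⟩

theorem tensor_eq_sum_basis {ι : Type*} [Fintype ι] [DecidableEq ι] (e : Module.Basis ι ℂ W)
    (t : W ⊗[ℂ] W) :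
    t = ∑ i, ∑ j, tensorToBilin W t (e.coord i) (e.coord j) • e i ⊗ₜ e j :=
  tensorToBilin_bijective.1 (tensorToBilin_basis e _).symm

/-- Transposing to `W ≅ W**` reduces to Schur for `W` and avoids proving `W*` irreducible. -/
theorem LieModule.exists_eq_smul_of_commute_dual {L : Type*} [LieRing L] [LieAlgebra ℂ L]
    [LieRingModule L W] [LieModule ℂ L W] (hirr : LieModule.IsIrreducible ℂ L W)
    (φ : Module.Dual ℂ W →ₗ[ℂ] Module.Dual ℂ W)
    (hφ : ∀ (x : L) f, φ ⁅x, f⁆ = ⁅x, φ f⁆) : ∃ c : ℂ, ∀ f, φ f = c • f := by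
  let g : W →ₗ[ℂ] W :=
    (Module.evalEquiv ℂ W).symm.toLinearMap ∘ₗ φ.dualMap ∘ₗ (Module.evalEquiv ℂ W).toLinearMap
  have hg : ∀ w f, f (g w) = φ f w := fun w f => by
    simp [g, Module.apply_evalEquiv_symm_apply]
  have hsep : ∀ u v : W, (∀ f : Module.Dual ℂ W, f u = f v) → u = v := fun u v h =>
    Module.eval_apply_injective ℂ (LinearMap.ext h)
  obtain ⟨c, hc⟩ := LieModule.exists_eq_smul_of_commute hirr g (fun x w => by
    refine hsep _ _ fun f => ?_
    have h1 : f ⁅x, g w⁆ = -(⁅x, f⁆ : Module.Dual ℂ W) (g w) := by simp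
    rw [hg, h1, hg, hφ]
    simp)
  refine ⟨c, fun f => LinearMap.ext fun w => ?_⟩
  rw [← hg, hc]
  simp

end TensorBilin

/-! ### Construction of the cubic form on the dual -/

section DualCubic

variable {L W : Type*} [LieRing L] [LieAlgebra ℂ L]
  [AddCommGroup W] [Module ℂ W] [Module.Finite ℂ W] [LieRingModule L W] [LieModule ℂ L W]
  {ι : Type*} [Fintype ι] {K : LinearMap.BilinForm ℂ L} {ζ : L →ₗ[ℂ] ℂ} {z : L} {b b' : ι → L}

namespace IsNormalizedForm

variable (hN : IsNormalizedForm W K ζ z)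
include hN

omit [Module.Finite ℂ W] in
theorem map_derived {x : L} (hx : x ∈ derivedIdeal L) : ζ x = 0 := by
  have h : (derivedIdeal L).toSubmodule ≤ LinearMap.ker ζ := by
    rw [LieSubmodule.lieIdeal_oper_eq_linear_span', Submodule.span_le]
    rintro _ ⟨x, -, y, -, rfl⟩
    exact hN.map_lie x y
  exact h hx

omit [Module.Finite ℂ W] in
theorem exists_derived_add (x : L) : ∃ y : derivedIdeal L, x = y + ζ x • z :=
  ⟨⟨x - ζ x • z, hN.mem_derived _ (by simp [hN.map_center])⟩, by simp⟩

omit [Module.Finite ℂ W] in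
theorem lie_dual (f : Module.Dual ℂ W) : ⁅z, f⁆ = -f := by
  ext w
  simp [hN.lie_self]

omit [Module.Finite ℂ W] in
theorem lie_tensor (t : W ⊗[ℂ] W) : ⁅z, t⁆ = (2 : ℂ) • t := by
  induction t using TensorProduct.induction_on with
  | zero => simp
  | add s t hs ht => rw [lie_add, hs, ht, smul_add]
  | tmul u v => rw [TensorProduct.LieModule.lie_tmul_right, hN.lie_self, hN.lie_self, two_smul]

omit [Module.Finite ℂ W] in
theorem cubicForm_apply_lie {C : CubicForm W} (hC : C.IsInvariant (derivedIdeal L))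
    (x : L) (u v w : W) :
    C.toFun ⁅x, u⁆ v w + C.toFun u ⁅x, v⁆ w + C.toFun u v ⁅x, w⁆
      = 3 * ζ x * C.toFun u v w := by
  obtain ⟨y, hy⟩ := hN.exists_derived_add x
  have h1 : ∀ w : W, ⁅x, w⁆ = ⁅y, w⁆ + ζ x • w := fun w => by
    conv_lhs => rw [hy, add_lie, smul_lie, hN.lie_self]
    rfl
  have h2 := hC y u v w
  simp only [h1, map_add, map_smul, LinearMap.add_apply, LinearMap.smul_apply, smul_eq_mul]
  linear_combination h2

/-- An injective `[L, L]`-equivariant family `W* → W ⊗ W` of symmetric tensors, complemented by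
eigenvectors of the split Casimir operator, determines a cubic form on `W*` from a cubic form
on `W`. -/
theorem exists_dual_cubicForm_of_decomposition (hd : IsDualPair K b b')
    (hirr : LieModule.IsIrreducible ℂ L W)
    (halt : altSquare ℂ L W = ⊥ ∨ LieModule.IsIrreducible ℂ L (altSquare ℂ L W))
    (C : CubicForm W) (hC : C.toFun ≠ 0) (hCinv : C.IsInvariant (derivedIdeal L))
    (ψ₀ : Module.Dual ℂ W →ₗ[ℂ] W ⊗[ℂ] W)
    (hψ₀ : ∀ (x : L) f, ⁅x, ψ₀ f⁆ = ψ₀ (⁅x, f⁆ + (3 * ζ x) • f))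
    (hsymm : ∀ f, TensorProduct.comm ℂ W W (ψ₀ f) = ψ₀ f)
    (hdec : ∀ t : W ⊗[ℂ] W, TensorProduct.comm ℂ W W t = t →
      ∃ f s, t = ψ₀ f + s ∧ splitCasimir W b b' s = (3 : ℂ) • s) :
    ∃ C' : CubicForm (Module.Dual ℂ W), C'.toFun ≠ 0 ∧ C'.IsInvariant (derivedIdeal L) ∧
      ∀ (t r : W) (f g : Module.Dual ℂ W), C'.toFun (C.toFun t r) f g
        = 3 / 2 * (f r * g t + f t * g r) - ∑ i, f ⁅b i, t⁆ * g ⁅b' i, r⁆ := by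
  have hW : Nontrivial W := LieModule.nontrivial_of_isIrreducible ℂ L W
  set n : ℂ := ((Module.finrank ℂ W : ℕ) : ℂ) with hn
  have hn3 : n + 3 ≠ 0 := by
    have h : ((Module.finrank ℂ W + 3 : ℕ) : ℂ) ≠ 0 := Nat.cast_ne_zero.mpr (by lia)
    rwa [Nat.cast_add] at h
  let e := Module.finBasis ℂ W
  let E := tensorToBilin W
  let T := splitCasimir W b b'
  let σ := TensorProduct.comm ℂ W W
  let Cs : W ⊗[ℂ] W →ₗ[ℂ] Module.Dual ℂ W := TensorProduct.lift C.toFun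
  have hCs : ∀ u v, Cs (u ⊗ₜ v) = C.toFun u v := fun u v => rfl
  have hCsσ : ∀ t, Cs (σ t) = Cs t := fun t => by
    induction t using TensorProduct.induction_on with
    | zero => simp
    | add s t hs ht => rw [map_add, map_add, map_add, hs, ht]
    | tmul u v => exact LinearMap.ext fun w => C.symm_left v u w
  have hCsx : ∀ (x : L) t, Cs ⁅x, t⁆ = ⁅x, Cs t⁆ + (3 * ζ x) • Cs t := fun x t => by
    induction t using TensorProduct.induction_on with
    | zero => simp
    | add s t hs ht => rw [lie_add, map_add, map_add, hs, ht, lie_add]; module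
    | tmul u v =>
      ext w
      have := hN.cubicForm_apply_lie hCinv x u v w
      simp only [TensorProduct.LieModule.lie_tmul_right, map_add, hCs, LinearMap.add_apply,
        LinearMap.smul_apply, Module.Dual.lie_apply, smul_eq_mul]
      linear_combination this
  have hCsT := hN.map_splitCasimir_of_twisted hd hirr Cs hCsx
  have hTψ := fun ψ hψ f => hN.splitCasimir_map_of_twisted hd hirr ψ hψ f
  -- Contraction with `C` converts `T` into `(3 - n)/2`, which differs from `3` by `(n + 3)/2 ≠ 0`.
  have hCs3 : ∀ s, T s = (3 : ℂ) • s → Cs s = 0 := fun s hs => by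
    have h1 := hCsT s
    rw [show splitCasimir W b b' s = (3 : ℂ) • s from hs, map_smul, ← sub_eq_zero, ← sub_smul,
      smul_eq_zero] at h1
    refine h1.resolve_left fun h => hn3 ?_
    linear_combination 2 * h
  have hscal : ∀ ψ : Module.Dual ℂ W →ₗ[ℂ] W ⊗[ℂ] W,
      (∀ (x : L) f, ⁅x, ψ f⁆ = ψ (⁅x, f⁆ + (3 * ζ x) • f)) → ∃ ν : ℂ, ∀ f, Cs (ψ f) = ν • f := by
    intro ψ hψ
    refine LieModule.exists_eq_smul_of_commute_dual hirr (Cs ∘ₗ ψ) fun x f => ?_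
    have h1 := congrArg Cs (hψ x f)
    rw [hCsx, map_add, map_add, map_smul, map_smul] at h1
    exact (add_right_cancel h1).symm
  obtain ⟨ν, hν⟩ := hscal ψ₀ hψ₀
  -- If `ν = 0`, contraction would kill both parts of every symmetric tensor, forcing `C = 0`.
  have hν0 : ν ≠ 0 := by
    rintro rfl
    refine hC (LinearMap.ext₂ fun u v => ?_)
    obtain ⟨f, s, hfs, hs⟩ := hdec (u ⊗ₜ v + v ⊗ₜ u) (by simp [add_comm])
    have h1 := congrArg Cs hfs
    rw [map_add, map_add, hν, hCs3 s hs, hCs, hCs, zero_smul, add_zero,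
      LinearMap.ext fun w => C.symm_left v u w, ← two_smul ℂ, smul_eq_zero] at h1
    exact h1.resolve_left two_ne_zero
  -- `D` is `ψ₀` as a trilinear form, known to be symmetric only in its last two arguments; `D₃`
  -- below is its full symmetrisation, up to a factor.
  let D : Module.Dual ℂ W →ₗ[ℂ] Module.Dual ℂ W →ₗ[ℂ] Module.Dual ℂ W →ₗ[ℂ] ℂ := E ∘ₗ ψ₀
  have hDs : ∀ f g h, D f g h = D f h g := fun f g h => by
    change E (ψ₀ f) g h = E (ψ₀ f) h g
    conv_lhs => rw [← hsymm f]
    exact tensorToBilin_comm _ _ _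
  have hDx : ∀ (x : L) f g h, D ⁅x, f⁆ g h + D f ⁅x, g⁆ h + D f g ⁅x, h⁆
      = -(3 * ζ x) * D f g h := fun x f g h => by
    have h1 := tensorToBilin_lie x (ψ₀ f) g h
    rw [hψ₀] at h1
    simp only [map_add, map_smul, LinearMap.add_apply, LinearMap.smul_apply, smul_eq_mul] at h1
    change E (ψ₀ ⁅x, f⁆) g h + E (ψ₀ f) ⁅x, g⁆ h + E (ψ₀ f) g ⁅x, h⁆ = -(3 * ζ x) * E (ψ₀ f) g h
    linear_combination h1
  let D₃ : Module.Dual ℂ W →ₗ[ℂ] Module.Dual ℂ W →ₗ[ℂ] Module.Dual ℂ W →ₗ[ℂ] ℂ :=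
    D + D.flip + LinearMap.lflip.toLinearMap ∘ₗ D.flip
  have hD₃ : ∀ f g h, D₃ f g h = D f g h + D g f h + D h f g := fun f g h => rfl
  let ψ : Module.Dual ℂ W →ₗ[ℂ] W ⊗[ℂ] W :=
    (LinearEquiv.ofBijective E tensorToBilin_bijective).symm.toLinearMap ∘ₗ D₃
  have hEψ : ∀ f, E (ψ f) = D₃ f := fun f =>
    (LinearEquiv.ofBijective E tensorToBilin_bijective).apply_symm_apply (D₃ f)
  have hψx : ∀ (x : L) f, ⁅x, ψ f⁆ = ψ (⁅x, f⁆ + (3 * ζ x) • f) := fun x f => by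
    refine tensorToBilin_bijective.1 (LinearMap.ext₂ fun g h => ?_)
    rw [tensorToBilin_lie]
    change -E (ψ f) ⁅x, g⁆ h - E (ψ f) g ⁅x, h⁆ = E (ψ _) g h
    simp only [hEψ, hD₃, map_add, map_smul, LinearMap.add_apply, LinearMap.smul_apply,
      smul_eq_mul]
    linear_combination -hDx x f g h - hDx x g f h - hDx x h f g
  have hψσ : ∀ f, σ (ψ f) = ψ f := fun f => by
    refine tensorToBilin_bijective.1 (LinearMap.ext₂ fun g h => ?_)
    rw [tensorToBilin_comm]
    change E (ψ f) h g = E (ψ f) g h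
    rw [hEψ, hD₃, hD₃, hDs f h g]
    ring
  obtain ⟨μ, hμ⟩ := hscal ψ hψx
  have hsum : ∀ (ψ : Module.Dual ℂ W →ₗ[ℂ] W ⊗[ℂ] W) (c : ℂ), (∀ f, Cs (ψ f) = c • f) →
      ∑ i, ∑ j, ∑ k, E (ψ (e.coord i)) (e.coord j) (e.coord k) * C.toFun (e j) (e k) (e i)
        = n * c := by
    intro ψ c h
    have h1 : ∀ i, ∑ j, ∑ k, E (ψ (e.coord i)) (e.coord j) (e.coord k)
        * C.toFun (e j) (e k) (e i) = c := fun i => by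
      have h2 := LinearMap.congr_fun (h (e.coord i)) (e i)
      rw [tensor_eq_sum_basis e (ψ (e.coord i))] at h2
      simpa [map_sum, hCs] using h2
    simp only [h1, Finset.sum_const, Finset.card_univ, Fintype.card_fin, nsmul_eq_mul, hn]
  -- Contract fully with `C`: because `C` is symmetric, each of the three terms of `D₃` contributes
  -- the same `n ν`.
  have hμν : μ = 3 * ν := by
    have h1 := hsum ψ μ hμ
    have h2 := hsum ψ₀ ν hν
    have h3 : ∑ i, ∑ j, ∑ k, D (e.coord j) (e.coord i) (e.coord k) * C.toFun (e j) (e k) (e i)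
        = n * ν := by
      rw [Finset.sum_comm, ← h2]
      refine Finset.sum_congr rfl fun i _ => Finset.sum_congr rfl fun j _ =>
        Finset.sum_congr rfl fun k _ => ?_
      rw [C.symm_right, C.symm_left, C.symm_right]
      rfl
    have h4 : ∑ i, ∑ j, ∑ k, D (e.coord k) (e.coord i) (e.coord j) * C.toFun (e j) (e k) (e i)
        = n * ν := by
      rw [← h3]
      refine Finset.sum_congr rfl fun i _ => ?_
      rw [Finset.sum_comm]
      refine Finset.sum_congr rfl fun j _ => Finset.sum_congr rfl fun k _ => ?_
      rw [C.symm_left]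
    have hn0 : n ≠ 0 := Nat.cast_ne_zero.mpr Module.finrank_pos.ne'
    refine mul_left_cancel₀ hn0 ?_
    rw [← h1]
    simp only [hEψ, hD₃, add_mul, Finset.sum_add_distrib]
    rw [h3, h4, show ∑ i, ∑ j, ∑ k, D (e.coord i) (e.coord j) (e.coord k)
      * C.toFun (e j) (e k) (e i) = n * ν from h2]
    ring
  -- The image of `ψ` also has eigenvalue `(3 - n)/2`, so it has no component of eigenvalue `3`;
  -- contraction with `C` then identifies the remaining one. Thus `D` was symmetric all along.
  have hψψ₀ : ∀ f, ψ f = (3 : ℂ) • ψ₀ f := fun f => by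
    obtain ⟨f', s, hfs, hs⟩ := hdec (ψ f) (hψσ f)
    have h1 := hTψ ψ hψx f
    rw [hfs, map_add, hTψ ψ₀ hψ₀, hs, smul_add, add_right_inj, ← sub_eq_zero, ← sub_smul,
      smul_eq_zero] at h1
    have hs0 : s = 0 := h1.resolve_left fun h => hn3 (by linear_combination 2 * h)
    rw [hs0, add_zero] at hfs
    have h2 := congrArg Cs hfs
    rw [hμ, hν, hμν, mul_comm, mul_smul] at h2
    have h3 : (3 : ℂ) • f = f' := smul_right_injective _ hν0 h2
    rw [hfs, ← h3, map_smul]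
  -- Chosen so that `c ν ψ = ((n + 3)/2) ψ₀`, matching the coefficient of the projection to `P` in
  -- `T`.
  let c : ℂ := (n + 3) / (6 * ν)
  have hc : c * (3 * ν) = (n + 3) / 2 := by
    simp only [c]; field_simp; norm_num
  have hc0 : c ≠ 0 := div_ne_zero hn3 (mul_ne_zero (by norm_num) hν0)
  have hcube : ∀ f, c • ν • ψ f = ((n + 3) / 2) • ψ₀ f := fun f => by
    rw [hψψ₀, ← hc]; module
  refine ⟨⟨c • D₃, fun f g h => ?_, fun f g h => ?_⟩, fun h0 => ?_, fun x f g h => ?_,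
    fun t r f g => ?_⟩
  · change c * D₃ f g h = c * D₃ g f h
    rw [hD₃, hD₃, hDs h f g]; ring
  · change c * D₃ f g h = c * D₃ f h g
    rw [hD₃, hD₃, hDs f g h]; ring
  · have hD0 : D₃ = 0 := (smul_eq_zero.mp h0).resolve_left hc0
    refine hν0 ?_
    have h1 : ∀ f : Module.Dual ℂ W, ν • f = 0 := fun f => by
      have h2 : ψ f = 0 := by
        refine tensorToBilin_bijective.1 ?_
        rw [map_zero]
        change E (ψ f) = 0
        rw [hEψ, hD0, LinearMap.zero_apply]
      have h3 := hμ f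
      rw [h2, map_zero, hμν, mul_smul] at h3
      exact (smul_eq_zero.mp h3.symm).resolve_left three_ne_zero
    obtain ⟨f, hf⟩ := exists_ne (0 : Module.Dual ℂ W)
    exact (smul_eq_zero.mp (h1 f)).resolve_right hf
  · change c * D₃ ⁅(x : L), f⁆ g h + c * D₃ f ⁅(x : L), g⁆ h + c * D₃ f g ⁅(x : L), h⁆ = 0
    have hx := hN.map_derived x.2
    simp only [hD₃]
    have h1 := hDx x f g h
    have h2 := hDx x g f h
    have h3 := hDx x h f g
    rw [hx] at h1 h2 h3
    linear_combination c * h1 + c * h2 + c * h3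
  · change c * D₃ (C.toFun t r) f g = _
    rw [← hEψ]
    obtain ⟨f', s, hfs, hs⟩ := hdec (t ⊗ₜ r + r ⊗ₜ t) (by simp [add_comm])
    have h1 := congrArg Cs hfs
    rw [map_add, map_add, hν, hCs3 s hs, hCs, hCs, add_zero,
      LinearMap.ext fun w => C.symm_left r t w, ← two_smul ℂ] at h1
    -- Vanishing of `T` on `Λ²W` lets the formula on symmetric tensors determine `T (t ⊗ r)` itself.
    have h2 : T (t ⊗ₜ r) = T (r ⊗ₜ t) := by
      rw [← sub_eq_zero, ← map_sub]
      refine hN.splitCasimir_eq_zero_of_mem_altSquare hd hirr halt ?_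
      change TensorProduct.comm ℂ W W _ = -_
      simp
    have h3 : T (t ⊗ₜ r + r ⊗ₜ t) = (3 : ℂ) • (t ⊗ₜ r + r ⊗ₜ t) - ((n + 3) / 2) • ψ₀ f' := by
      rw [hfs, map_add, hTψ ψ₀ hψ₀, hs]
      module
    have h4 : (2 * c) • ψ (C.toFun t r) = (3 : ℂ) • (t ⊗ₜ r + r ⊗ₜ t) - (2 : ℂ) • T (t ⊗ₜ r) := by
      rw [two_smul ℂ (T _)]
      nth_rewrite 2 [h2]
      rw [← map_add, h3, ← hcube, mul_comm, mul_smul, ← map_smul, h1, map_smul]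
      module
    have h5 := LinearMap.congr_fun₂ (congrArg E h4) f g
    have h6 : E (T (t ⊗ₜ r)) f g = ∑ i, f ⁅b i, t⁆ * g ⁅b' i, r⁆ := by
      simp [E, T, splitCasimir_tmul, map_sum]
    simp only [map_sub, map_add, map_smul, LinearMap.sub_apply, LinearMap.add_apply,
      LinearMap.smul_apply, smul_eq_mul, h6] at h5
    have h7 : ∀ u v : W, E (u ⊗ₜ v) f g = f u * g v := fun _ _ => rfl
    rw [h7, h7] at h5
    linear_combination (1 / 2 : ℂ) * h5

end IsNormalizedForm

end DualCubic

/-! ### The eigenvalue 3 on the complement of `P` -/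

section Decomposition

variable {L W : Type*} [LieRing L] [LieAlgebra ℂ L]
  [AddCommGroup W] [Module ℂ W] [LieRingModule L W] [LieModule ℂ L W]
  {ι : Type*} [Fintype ι] {K : LinearMap.BilinForm ℂ L} {ζ : L →ₗ[ℂ] ℂ} {z : L} {b b' : ι → L}

namespace IsNormalizedForm

variable (hN : IsNormalizedForm W K ζ z)
include hN

theorem twisted_of_derived (ψ : Module.Dual ℂ W →ₗ[ℂ] W ⊗[ℂ] W)
    (hψ : ∀ (y : derivedIdeal L) f, ψ ⁅y, f⁆ = ⁅(y : L), ψ f⁆) (x : L) (f : Module.Dual ℂ W) :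
    ⁅x, ψ f⁆ = ψ (⁅x, f⁆ + (3 * ζ x) • f) := by
  obtain ⟨y, hy⟩ := hN.exists_derived_add x
  have h1 : ⁅x, f⁆ = ⁅y, f⁆ - ζ x • f := by
    conv_lhs => rw [hy, add_lie, smul_lie, hN.lie_dual, smul_neg, ← sub_eq_add_neg]
    rfl
  have h2 : ⁅x, ψ f⁆ = ⁅(y : L), ψ f⁆ + (2 * ζ x) • ψ f := by
    conv_lhs => rw [hy, add_lie, smul_lie, hN.lie_tensor, smul_smul, mul_comm]
  rw [h1, h2, ← hψ, map_add, map_sub, map_smul, map_smul]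
  module

/-- The split Casimir operator acts by a scalar on every irreducible `[L, L]`-submodule
of `W ⊗ W`. -/
theorem exists_splitCasimir_eq_smul [Module.Finite ℂ W]
    (hd : IsDualPair K b b') (hirr : LieModule.IsIrreducible ℂ L W)
    {S : Type*} [AddCommGroup S] [Module ℂ S] [Module.Finite ℂ S]
    [LieRingModule (derivedIdeal L) S] [LieModule ℂ (derivedIdeal L) S]
    (hS : LieModule.IsIrreducible ℂ (derivedIdeal L) S) (j : S →ₗ[ℂ] W ⊗[ℂ] W)
    (ρ : W ⊗[ℂ] W →ₗ[ℂ] S) (hρ : ∀ s, ρ (j s) = s)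
    (hj : ∀ (y : derivedIdeal L) s, j ⁅y, s⁆ = ⁅(y : L), j s⁆) :
    ∃ c : ℂ, ∀ s, splitCasimir W b b' (j s) = c • j s := by
  -- Stability extends from `[L, L]` to `L` because `z` acts on `W ⊗ W` as the scalar `2`; hence `T`
  -- preserves the range.
  have hstab : ∀ (x : L), ∀ t ∈ LinearMap.range j, ⁅x, t⁆ ∈ LinearMap.range j := by
    rintro x _ ⟨s, rfl⟩
    obtain ⟨y, hy⟩ := hN.exists_derived_add x
    refine ⟨⁅y, s⁆ + (2 * ζ x) • s, ?_⟩
    conv_rhs => rw [hy, add_lie, smul_lie, hN.lie_tensor, smul_smul, mul_comm]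
    rw [map_add, map_smul, hj]
  have hT : ∀ s, splitCasimir W b b' (j s) ∈ LinearMap.range j := fun s => by
    rw [hN.splitCasimir_eq hd hirr, casimirEnd_apply]
    exact Submodule.sub_mem _ (Submodule.smul_mem _ _ (Submodule.sum_mem _ fun i _ =>
      hstab _ _ (hstab _ _ ⟨s, rfl⟩))) (Submodule.smul_mem _ _ ⟨s, rfl⟩)
  have hTρ : ∀ s, j (ρ (splitCasimir W b b' (j s))) = splitCasimir W b b' (j s) := fun s => by
    obtain ⟨s', hs'⟩ := hT s
    rw [← hs', hρ]
  have hinj : Function.Injective j := Function.LeftInverse.injective hρ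
  obtain ⟨c, hc⟩ := LieModule.exists_eq_smul_of_commute hS (ρ ∘ₗ splitCasimir W b b' ∘ₗ j)
    fun y s => hinj (by
      simp only [LinearMap.comp_apply]
      rw [hTρ, hj, hj, hTρ, hN.splitCasimir_lie hd hirr])
  refine ⟨c, fun s => ?_⟩
  rw [← hTρ, ← map_smul, ← hc]
  rfl

/-- `T` is known on `P` and is a scalar on `S`, so the trace of `T` on `S²W` determines that scalar.
-/
theorem exists_decomposition [Module.Finite ℂ W]
    (hd : IsDualPair K b b') (hirr : LieModule.IsIrreducible ℂ L W)
    (P S : LieSubmodule ℂ (derivedIdeal L) (symSquare ℂ (derivedIdeal L) W))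
    (hPS : IsCompl P S) (hP : Nonempty (P ≃ₗ⁅ℂ, derivedIdeal L⁆ Module.Dual ℂ W))
    (hS : S = ⊥ ∨ LieModule.IsIrreducible ℂ (derivedIdeal L) S) :
    ∃ ψ₀ : Module.Dual ℂ W →ₗ[ℂ] W ⊗[ℂ] W,
      (∀ (x : L) f, ⁅x, ψ₀ f⁆ = ψ₀ (⁅x, f⁆ + (3 * ζ x) • f)) ∧
      (∀ f, TensorProduct.comm ℂ W W (ψ₀ f) = ψ₀ f) ∧
      ∀ t : W ⊗[ℂ] W, TensorProduct.comm ℂ W W t = t →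
        ∃ f s, t = ψ₀ f + s ∧ splitCasimir W b b' s = (3 : ℂ) • s := by
  obtain ⟨φ⟩ := hP
  let σ := (TensorProduct.comm ℂ W W).toLinearMap
  have hσσ : ∀ t, σ (σ t) = t := fun t => by simp [σ]
  let Q := symSquare ℂ (derivedIdeal L) W
  have hQ : ∀ q : Q, σ (q : W ⊗[ℂ] W) = q := fun q => q.2
  let jP : P →ₗ[ℂ] W ⊗[ℂ] W := Q.toSubmodule.subtype ∘ₗ P.toSubmodule.subtype
  let jS : S →ₗ[ℂ] W ⊗[ℂ] W := Q.toSubmodule.subtype ∘ₗ S.toSubmodule.subtype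
  have hPS' : IsCompl P.toSubmodule S.toSubmodule := LieSubmodule.isCompl_toSubmodule.mpr hPS
  let sym : W ⊗[ℂ] W →ₗ[ℂ] W ⊗[ℂ] W := (1 / 2 : ℂ) • (LinearMap.id + σ)
  have hsym : ∀ t, sym t = (1 / 2 : ℂ) • (t + σ t) := fun t => rfl
  have hsymQ : ∀ t, sym t ∈ Q.toSubmodule := fun t => by
    change σ (sym t) = sym t
    rw [hsym, map_smul, map_add, hσσ, add_comm]
  have hsymσ : ∀ t, σ t = t → sym t = t := fun t ht => by
    rw [hsym, ht]; module
  let symQ : W ⊗[ℂ] W →ₗ[ℂ] Q := sym.codRestrict Q.toSubmodule hsymQ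
  have hsymQ' : ∀ q : Q, symQ q = q := fun q => Subtype.ext (hsymσ _ (hQ q))
  let ρP : W ⊗[ℂ] W →ₗ[ℂ] P := P.toSubmodule.projectionOnto S.toSubmodule hPS' ∘ₗ symQ
  let ρS : W ⊗[ℂ] W →ₗ[ℂ] S := S.toSubmodule.projectionOnto P.toSubmodule hPS'.symm ∘ₗ symQ
  have hρP : ∀ s, ρP (jP s) = s := fun s => by
    change P.toSubmodule.projectionOnto S.toSubmodule hPS' (symQ ((s : Q) : W ⊗[ℂ] W)) = s
    rw [hsymQ']
    exact Submodule.projectionOnto_apply_left hPS' s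
  have hρS : ∀ s, ρS (jS s) = s := fun s => by
    change S.toSubmodule.projectionOnto P.toSubmodule hPS'.symm (symQ ((s : Q) : W ⊗[ℂ] W)) = s
    rw [hsymQ']
    exact Submodule.projectionOnto_apply_left hPS'.symm s
  have hadd : ∀ t, jP (ρP t) + jS (ρS t) = sym t := fun t =>
    congrArg Subtype.val (Submodule.projection_add_projection_eq_self hPS' (symQ t))
  let ψ₀ : Module.Dual ℂ W →ₗ[ℂ] W ⊗[ℂ] W := jP ∘ₗ (φ.symm : Module.Dual ℂ W →ₗ[ℂ] P)
  have hψ₀ := hN.twisted_of_derived ψ₀ (fun y f => by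
    change jP (φ.symm ⁅y, f⁆) = ⁅(y : L), jP (φ.symm f)⁆
    exact congrArg jP (φ.symm.toLieModuleHom.map_lie y f))
  have hP3 : ∀ s, splitCasimir W b b' (jP s)
      = ((3 - Module.finrank ℂ W) / 2 : ℂ) • jP s := fun s => by
    have := hN.splitCasimir_map_of_twisted hd hirr ψ₀ hψ₀ (φ s)
    rwa [show ψ₀ (φ s) = jP s from congrArg jP (φ.symm_apply_apply s)] at this
  have hS3 : ∀ s, splitCasimir W b b' (jS s) = (3 : ℂ) • jS s := by
    rcases hS with hS | hS
    · intro s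
      have hs : s = 0 := by
        have h : ∀ q ∈ S, q = 0 := fun q hq => by rwa [hS, LieSubmodule.mem_bot] at hq
        exact Subtype.ext (h s s.2)
      rw [hs, map_zero, map_zero, smul_zero]
    · obtain ⟨c, hc⟩ := hN.exists_splitCasimir_eq_smul hd hirr hS jS ρS hρS fun y s => rfl
      have hnt : Nontrivial S := LieModule.nontrivial_of_isIrreducible ℂ (derivedIdeal L) S
      set n : ℂ := ((Module.finrank ℂ W : ℕ) : ℂ)
      have htrσ : LinearMap.trace ℂ _ σ = n := by
        have := LinearMap.trace_map_comp_comm (W := W) LinearMap.id LinearMap.id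
        rwa [TensorProduct.map_id, LinearMap.id_comp, LinearMap.id_comp,
          LinearMap.trace_id] at this
      have htrP : LinearMap.trace ℂ _ (jP ∘ₗ ρP) = n := by
        rw [LinearMap.trace_comp_comm', show ρP ∘ₗ jP = LinearMap.id from LinearMap.ext hρP,
          LinearMap.trace_id, (φ : P ≃ₗ[ℂ] Module.Dual ℂ W).finrank_eq,
          Subspace.dual_finrank_eq]
      have htrS : LinearMap.trace ℂ _ (jS ∘ₗ ρS) = Module.finrank ℂ S := by
        rw [LinearMap.trace_comp_comm', show ρS ∘ₗ jS = LinearMap.id from LinearMap.ext hρS,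
          LinearMap.trace_id]
      have hS0 : (Module.finrank ℂ S : ℂ) ≠ 0 := Nat.cast_ne_zero.mpr Module.finrank_pos.ne'
      have h1 : jP ∘ₗ ρP + jS ∘ₗ ρS = (1 / 2 : ℂ) • (LinearMap.id + σ) := LinearMap.ext hadd
      have h2 : ((3 - n) / 2) • (jP ∘ₗ ρP) + c • (jS ∘ₗ ρS)
          = (1 / 2 : ℂ) • (splitCasimir W b b' + splitCasimir W b b' ∘ₗ σ) := by
        refine LinearMap.ext fun t => ?_
        have h3 := congrArg (splitCasimir W b b') (hadd t)
        rw [map_add, hP3, hc, hsym, map_smul, map_add] at h3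
        exact h3
      have h3 := congrArg (LinearMap.trace ℂ _) h1
      have h4 := congrArg (LinearMap.trace ℂ _) h2
      simp only [map_add, map_smul, htrP, htrS, htrσ, LinearMap.trace_id, smul_eq_mul,
        hN.trace_splitCasimir hd,
        Module.finrank_tensorProduct, Nat.cast_mul] at h3 h4
      rw [hN.trace_splitCasimir_comp_comm hd hirr] at h4
      -- From `n + dim S = (n² + n)/2` and `n(3 - n)/2 + c dim S = n²` one gets `(c - 3) dim S = 0`.
      have hc3 : c = 3 := by
        refine mul_right_cancel₀ hS0 ?_
        linear_combination h4 - 3 * h3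
      exact fun s => by rw [hc, hc3]
  refine ⟨ψ₀, hψ₀, fun f => hQ _, fun t ht => ⟨φ (ρP t), jS (ρS t), ?_, hS3 _⟩⟩
  rw [show ψ₀ (φ (ρP t)) = jP (ρP t) from congrArg jP (φ.symm_apply_apply _), hadd, hsymσ t ht]

end IsNormalizedForm

end Decomposition

/-! ### The module `ℂ ⊕ W ⊕ W* ⊕ ℂ` -/

section Module

variable {L W : Type*} [LieRing L] [LieAlgebra ℂ L]
  [AddCommGroup W] [Module ℂ W] [LieRingModule L W] [LieModule ℂ L W]

/-- The compatibilities between `θ`, a linear form `ζ` on `L` and cubic forms `C`, `C'` on `W`, `W*`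
under which `L ⊕ W ⊕ W*` acts on `ℂ ⊕ W ⊕ W* ⊕ ℂ`. -/
structure IsCubicPair (θ : W →ₗ[ℂ] Module.Dual ℂ W →ₗ[ℂ] L) (ζ : L →ₗ[ℂ] ℂ)
    (C : CubicForm W) (C' : CubicForm (Module.Dual ℂ W)) : Prop where
  map_lie : ∀ x y : L, ζ ⁅x, y⁆ = 0
  map_pairing : ∀ u f, ζ (θ u f) = f u
  lie_left : ∀ (x : L) u v w, C.toFun ⁅x, u⁆ v w + C.toFun u ⁅x, v⁆ w + C.toFun u v ⁅x, w⁆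
    = 3 * ζ x * C.toFun u v w
  lie_right : ∀ (x : L) f g h, C'.toFun ⁅x, f⁆ g h + C'.toFun f ⁅x, g⁆ h + C'.toFun f g ⁅x, h⁆
    = -(3 * ζ x) * C'.toFun f g h
  comp : ∀ t r f g, C'.toFun (C.toFun t r) f g
    = 3 / 2 * (f r * g t + f t * g r) - g ⁅θ t f, r⁆

variable [Module.Finite ℂ W] {θ : W →ₗ[ℂ] Module.Dual ℂ W →ₗ[ℂ] L} {hθ : IsLiePairing θ}
  {ζ : L →ₗ[ℂ] ℂ} {C : CubicForm W} {C' : CubicForm (Module.Dual ℂ W)}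

/-- The contraction `C'(f s) ∈ W` of a cubic form on `W*`. -/
def CubicForm.contract (C' : CubicForm (Module.Dual ℂ W)) (f s : Module.Dual ℂ W) : W :=
  (Module.evalEquiv ℂ W).symm (C'.toFun f s)

@[simp]
theorem CubicForm.apply_contract (f s g : Module.Dual ℂ W) :
    g (C'.contract f s) = C'.toFun f s g :=
  by
  simp [CubicForm.contract, Module.apply_evalEquiv_symm_apply]

theorem Module.Dual.ext_iff_eval (u v : W) : u = v ↔ ∀ f : Module.Dual ℂ W, f u = f v :=
  ⟨fun h _ => by rw [h], fun h => Module.eval_apply_injective ℂ (LinearMap.ext h)⟩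

/-- The action of `L ⊕ W ⊕ W*` on `ℂ ⊕ W ⊕ W* ⊕ ℂ`. -/
def cubicBracket (ζ : L →ₗ[ℂ] ℂ) (C : CubicForm W) (C' : CubicForm (Module.Dual ℂ W))
    (a : L × W × Module.Dual ℂ W) (v : ℂ × W × Module.Dual ℂ W × ℂ) :
    ℂ × W × Module.Dual ℂ W × ℂ :=
  (-(3 / 2) * ζ a.1 * v.1 + 1 / 2 * a.2.2 v.2.1,
    ⁅a.1, v.2.1⁆ - (3 / 2 * ζ a.1) • v.2.1 + (3 * v.1) • a.2.1 + C'.contract a.2.2 v.2.2.1,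
    ⁅a.1, v.2.2.1⁆ + (3 / 2 * ζ a.1) • v.2.2.1 + C.toFun a.2.1 v.2.1 + (3 * v.2.2.2) • a.2.2,
    3 / 2 * ζ a.1 * v.2.2.2 + 1 / 2 * v.2.2.1 a.2.1)

theorem CubicForm.apply_lie_contract (x : L) (f s g : Module.Dual ℂ W) :
    g ⁅x, C'.contract f s⁆ = -C'.toFun f s ⁅x, g⁆ := by
  rw [← CubicForm.apply_contract, Module.Dual.lie_apply, neg_neg]

theorem CubicForm.apply_contract_left (t w : W) (f s : Module.Dual ℂ W) :
    C.toFun t (C'.contract f s) w = C'.toFun (C.toFun t w) f s := by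
  rw [C.symm_right, CubicForm.apply_contract, C'.symm_right, C'.symm_left]

theorem cubicBracket_ext {p q : ℂ × W × Module.Dual ℂ W × ℂ} (h1 : p.1 = q.1)
    (h2 : ∀ g : Module.Dual ℂ W, g p.2.1 = g q.2.1) (h3 : ∀ w, p.2.2.1 w = q.2.2.1 w)
    (h4 : p.2.2.2 = q.2.2.2) : p = q :=
  Prod.ext h1 (Prod.ext ((Module.Dual.ext_iff_eval _ _).mpr h2)
    (Prod.ext (LinearMap.ext h3) h4))

/-- In the two outer components, symmetry of the cubic forms and the behaviour of `ζ` suffice. The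
identity `comp` enters only in the middle ones, where an element of `W` meets one of `W*`. -/
theorem IsCubicPair.leibniz (h : IsCubicPair θ ζ C C') (hθ : IsLiePairing θ)
    (a b : GradedLie θ hθ) (v : ℂ × W × Module.Dual ℂ W × ℂ) :
    cubicBracket ζ C C' a (cubicBracket ζ C C' b v)
      = cubicBracket ζ C C' (⁅a, b⁆ : GradedLie θ hθ) v + cubicBracket ζ C C' b (cubicBracket ζ C C' a v) := by
  obtain ⟨x, t, f⟩ := a
  obtain ⟨y, u, k⟩ := b
  obtain ⟨α, r, s, β⟩ := v
  change _ = cubicBracket ζ C C' (⁅x, y⁆ + θ t k - θ u f, ⁅x, u⁆ - ⁅y, t⁆, ⁅x, k⁆ - ⁅y, f⁆) _ + _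
  refine cubicBracket_ext ?_ (fun g => ?_) (fun w => ?_) ?_
  · simp only [cubicBracket, Prod.fst_add, map_add, map_sub, map_smul, smul_eq_mul,
      LinearMap.add_apply, LinearMap.sub_apply, LinearMap.smul_apply, Module.Dual.lie_apply,
      CubicForm.apply_contract, h.map_lie, h.map_pairing]
    rw [C'.symm_left k s f, C'.symm_left f s k, C'.symm_right s f k]
    ring
  · simp only [cubicBracket, Prod.fst_add, Prod.snd_add, map_add, map_sub, map_smul, smul_eq_mul,
      LinearMap.add_apply, LinearMap.sub_apply, LinearMap.smul_apply, Module.Dual.lie_apply,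
      CubicForm.apply_contract, h.map_lie, h.map_pairing, lie_add, lie_sub, lie_smul, add_lie,
      sub_lie, lie_lie, CubicForm.apply_lie_contract]
    have e1 := C'.symm_left f (C.toFun u r) g
    have e2 := C'.symm_left k (C.toFun t r) g
    have e3 := C'.symm_left f k g
    linear_combination e1 - e2 + 3 * β * e3 + h.comp u r f g - h.comp t r k g
      - h.lie_right x k s g + h.lie_right y f s g
  · simp only [cubicBracket, Prod.fst_add, Prod.snd_add, map_add, map_sub, map_smul, smul_eq_mul,
      LinearMap.add_apply, LinearMap.sub_apply, LinearMap.smul_apply, Module.Dual.lie_apply,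
      CubicForm.apply_contract, h.map_lie, h.map_pairing, lie_add, lie_sub, lie_smul, add_lie,
      sub_lie, lie_lie, CubicForm.apply_contract_left]
    linear_combination 3 * α * C.symm_left t u w + h.comp t w k s - h.comp u w f s
      - h.lie_left x u r w + h.lie_left y t r w
  · simp only [cubicBracket, Prod.snd_add, map_add, map_sub, map_smul, smul_eq_mul,
      LinearMap.add_apply, LinearMap.sub_apply, LinearMap.smul_apply, Module.Dual.lie_apply,
      h.map_lie, h.map_pairing]
    rw [C.symm_right u r t, C.symm_left u t r, C.symm_right t u r]
    ring

theorem CubicForm.contract_eq_zero_left (s : Module.Dual ℂ W) : C'.contract 0 s = 0 := by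
  simp [CubicForm.contract]

/-- The module structure on `ℂ ⊕ W ⊕ W* ⊕ ℂ` over the graded Lie algebra `L ⊕ W ⊕ W*`. -/
@[reducible]
def IsCubicPair.lieRingModule (h : IsCubicPair θ ζ C C') (hθ : IsLiePairing θ) :
    LieRingModule (GradedLie θ hθ) (ℂ × W × Module.Dual ℂ W × ℂ) where
  bracket a v := cubicBracket ζ C C' a v
  add_lie a b v := by
    change cubicBracket ζ C C' (a.1 + b.1, a.2.1 + b.2.1, a.2.2 + b.2.2) v = _
    refine cubicBracket_ext ?_ (fun g => ?_) (fun w => ?_) ?_ <;>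
    · simp only [cubicBracket, Prod.fst_add, Prod.snd_add, map_add, map_smul, smul_eq_mul,
        LinearMap.add_apply, LinearMap.smul_apply, CubicForm.apply_contract, add_lie, map_sub]
      ring
  lie_add a v w := by
    refine cubicBracket_ext ?_ (fun g => ?_) (fun w => ?_) ?_ <;>
    · simp only [cubicBracket, Prod.fst_add, Prod.snd_add, map_add, map_smul, smul_eq_mul,
        LinearMap.add_apply, LinearMap.smul_apply, CubicForm.apply_contract, lie_add, map_sub]
      ring
  leibniz_lie a b v := h.leibniz hθ a b v

theorem IsCubicPair.lieModule (h : IsCubicPair θ ζ C C') (hθ : IsLiePairing θ) :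
    letI := h.lieRingModule hθ
    LieModule ℂ (GradedLie θ hθ) (ℂ × W × Module.Dual ℂ W × ℂ) :=
  letI := h.lieRingModule hθ
  { smul_lie := fun c a v => by
      change cubicBracket ζ C C' (c • a.1, c • a.2.1, c • a.2.2) v = c • cubicBracket ζ C C' a v
      refine cubicBracket_ext ?_ (fun g => ?_) (fun w => ?_) ?_ <;>
      · simp only [cubicBracket, Prod.smul_fst, Prod.smul_snd, map_add, map_smul, smul_eq_mul,
          LinearMap.add_apply, LinearMap.smul_apply, CubicForm.apply_contract, smul_lie, map_sub]
        ring
    lie_smul := fun c a v => by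
      change cubicBracket ζ C C' a (c • v) = c • cubicBracket ζ C C' a v
      refine cubicBracket_ext ?_ (fun g => ?_) (fun w => ?_) ?_ <;>
      · simp only [cubicBracket, Prod.smul_fst, Prod.smul_snd, map_add, map_smul, smul_eq_mul,
          LinearMap.add_apply, LinearMap.smul_apply, CubicForm.apply_contract, lie_smul, map_sub]
        ring }

theorem cubicBracket_zero_left_zero (x : L) (v : ℂ × W × Module.Dual ℂ W × ℂ) :
    cubicBracket ζ C C' (x, 0, 0) v
      = (-(3 / 2) * ζ x * v.1, ⁅x, v.2.1⁆ - (3 / 2 * ζ x) • v.2.1,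
        ⁅x, v.2.2.1⁆ + (3 / 2 * ζ x) • v.2.2.1, 3 / 2 * ζ x * v.2.2.2) := by
  simp [cubicBracket, CubicForm.contract_eq_zero_left]

theorem cubicBracket_raise (t : W) (v : ℂ × W × Module.Dual ℂ W × ℂ) :
    cubicBracket ζ C C' ((0 : L), t, 0) v
      = (0, (3 * v.1) • t, C.toFun t v.2.1, 1 / 2 * v.2.2.1 t) := by
  simp [cubicBracket, CubicForm.contract_eq_zero_left]

theorem cubicBracket_lower (f : Module.Dual ℂ W) (v : ℂ × W × Module.Dual ℂ W × ℂ) :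
    cubicBracket ζ C C' ((0 : L), 0, f) v
      = (1 / 2 * f v.2.1, C'.contract f v.2.2.1, (3 * v.2.2.2) • f, 0) := by
  simp [cubicBracket]

theorem IsCubicPair.isCubicAction (h : IsCubicPair θ ζ C C') (hθ : IsLiePairing θ)
    {z : L} (hz : z ∈ LieAlgebra.center ℂ L) (hzW : ∀ w : W, ⁅z, w⁆ = w) (hζz : ζ z = 1)
    (hder : ∀ x ∈ derivedIdeal L, ζ x = 0) :
    letI := h.lieRingModule hθ
    IsCubicAction θ hθ C C' :=
  letI := h.lieRingModule hθ
  { derived_act := fun x hx a r s b => by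
      change cubicBracket ζ C C' (x, 0, 0) _ = _
      rw [cubicBracket_zero_left_zero, hder x hx]
      simp
    center_act := by
      refine ⟨z, hz, hzW, fun a r s b => ?_⟩
      change cubicBracket ζ C C' (z, 0, 0) _ = _
      rw [cubicBracket_zero_left_zero, hζz, hzW]
      have hs : ⁅z, s⁆ = -s := LinearMap.ext fun w => by simp [hzW]
      rw [hs]
      refine cubicBracket_ext ?_ (fun g => ?_) (fun w => ?_) ?_
      · simp
      · simp only [map_sub, map_smul, smul_eq_mul]; ring
      · simp only [LinearMap.add_apply, LinearMap.neg_apply, LinearMap.smul_apply, smul_eq_mul]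
        ring
      · simp
    raise_act := fun t a r s b => cubicBracket_raise t _
    lower_act := fun f a r s b => cubicBracket_lower f _ }

/-- The four summands are the eigenspaces of `z`, so a nonzero submodule contains a nonzero vector
of one summand. Raising and lowering from it reaches all the others, the passage between `W` and
`W*` using that the cubic forms are nonzero. -/
theorem IsCubicPair.isIrreducible [Nontrivial W] (h : IsCubicPair θ ζ C C')
    (hθ : IsLiePairing θ) {z : L} (hzW : ∀ w : W, ⁅z, w⁆ = w) (hζz : ζ z = 1)
    (hC : C.toFun ≠ 0) (hC' : C'.toFun ≠ 0) :
    letI := h.lieRingModule hθ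
    LieModule.IsIrreducible ℂ (GradedLie θ hθ) (ℂ × W × Module.Dual ℂ W × ℂ) := by
  let _ := h.lieRingModule hθ
  refine LieModule.IsIrreducible.mk fun N hN => ?_
  have hlie : ∀ (x : L) (t : W) (f : Module.Dual ℂ W) {v}, v ∈ N →
      cubicBracket ζ C C' (x, t, f) v ∈ N := fun x t f v hv =>
    N.lie_mem (x := GradedLie.mk θ hθ x t f) hv
  have hraise : ∀ (t : W) {v}, v ∈ N →
      ((0, (3 * v.1) • t, C.toFun t v.2.1, 1 / 2 * v.2.2.1 t) : ℂ × W × Module.Dual ℂ W × ℂ) ∈ N :=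
    fun t v hv => cubicBracket_raise (ζ := ζ) (C := C) (C' := C') t v ▸ hlie 0 t 0 hv
  have hlower : ∀ (f : Module.Dual ℂ W) {v}, v ∈ N →
      ((1 / 2 * f v.2.1, C'.contract f v.2.2.1, (3 * v.2.2.2) • f, 0) :
        ℂ × W × Module.Dual ℂ W × ℂ) ∈ N :=
    fun f v hv => cubicBracket_lower (ζ := ζ) (C := C) (C' := C') f v ▸ hlie 0 0 f hv
  have htop : ∀ {a : ℂ}, a ≠ 0 → ((a, 0, 0, 0) : ℂ × W × Module.Dual ℂ W × ℂ) ∈ N → N = ⊤ := by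
    intro a ha hmem
    have h1 : ∀ c : ℂ, ((c, 0, 0, 0) : ℂ × W × Module.Dual ℂ W × ℂ) ∈ N := fun c => by
      simpa [ha] using N.smul_mem (c / a) hmem
    have h2 : ∀ r : W, ((0, r, 0, 0) : ℂ × W × Module.Dual ℂ W × ℂ) ∈ N := fun r => by
      simpa using hraise r (h1 (1 / 3))
    obtain ⟨t, r, w, htrw⟩ : ∃ t r w, C.toFun t r w ≠ 0 := by
      by_contra! hcon
      exact hC (LinearMap.ext₂ fun t r => LinearMap.ext (hcon t r))
    have h3 : ((0, 0, C.toFun t r, 0) : ℂ × W × Module.Dual ℂ W × ℂ) ∈ N := by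
      simpa using hraise t (h2 r)
    have h4 : ∀ c : ℂ, ((0, 0, 0, c) : ℂ × W × Module.Dual ℂ W × ℂ) ∈ N := fun c => by
      have h := N.smul_mem (2 * c / C.toFun t r w) (hraise w h3)
      have hc : 2 * c / C.toFun t r w * (1 / 2 * C.toFun t r w) = c := by field_simp
      rw [Prod.smul_mk, Prod.smul_mk, Prod.smul_mk, smul_eq_mul, smul_eq_mul, hc] at h
      simpa using h
    have h5 : ∀ s : Module.Dual ℂ W, ((0, 0, s, 0) : ℂ × W × Module.Dual ℂ W × ℂ) ∈ N :=
      fun s => by simpa [CubicForm.contract] using hlower s (h4 (1 / 3))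
    refine eq_top_iff.mpr fun ⟨a, r, s, b⟩ _ => ?_
    have h6 := N.add_mem (N.add_mem (h1 a) (h2 r)) (N.add_mem (h5 s) (h4 b))
    simpa using h6
  have htopW : ∀ {r : W}, r ≠ 0 → ((0, r, 0, 0) : ℂ × W × Module.Dual ℂ W × ℂ) ∈ N → N = ⊤ := by
    intro r hr hmem
    obtain ⟨f, hf⟩ := Module.Projective.exists_dual_ne_zero ℂ hr
    exact htop (a := 1 / 2 * f r) (mul_ne_zero (by norm_num) hf)
      (by simpa [CubicForm.contract] using hlower f hmem)
  have htopβ : ∀ {b : ℂ}, b ≠ 0 → ((0, 0, 0, b) : ℂ × W × Module.Dual ℂ W × ℂ) ∈ N → N = ⊤ := by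
    intro b hb hmem
    obtain ⟨f, s, g, hfsg⟩ : ∃ f s g, C'.toFun f s g ≠ 0 := by
      by_contra! hcon
      exact hC' (LinearMap.ext₂ fun t r => LinearMap.ext (hcon t r))
    have h1 : ((0, 0, s, 0) : ℂ × W × Module.Dual ℂ W × ℂ) ∈ N := by
      have h := N.smul_mem (1 / (3 * b)) (hlower s hmem)
      have hc : 1 / (3 * b) * (3 * b) = 1 := by field_simp
      rw [Prod.smul_mk, Prod.smul_mk, Prod.smul_mk, smul_smul, hc] at h
      simpa [CubicForm.contract] using h
    refine htopW (r := C'.contract f s) (fun h0 => hfsg ?_) (by simpa using hlower f h1)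
    rw [← CubicForm.apply_contract, h0, map_zero]
  have htopD : ∀ {s : Module.Dual ℂ W}, s ≠ 0 →
      ((0, 0, s, 0) : ℂ × W × Module.Dual ℂ W × ℂ) ∈ N → N = ⊤ := by
    intro s hs hmem
    obtain ⟨w, hw⟩ : ∃ w, s w ≠ 0 := by
      by_contra! hcon
      exact hs (LinearMap.ext hcon)
    exact htopβ (b := 1 / 2 * s w) (mul_ne_zero (by norm_num) hw) (by simpa using hraise w hmem)
  -- This is the action of `2z`, with eigenvalues `-3, -1, 1, 3`.
  have hY : ∀ {a : ℂ} {r : W} {s : Module.Dual ℂ W} {b : ℂ}, (a, r, s, b) ∈ N →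
      (-3 * a, -r, s, 3 * b) ∈ N := by
    intro a r s b hmem
    have h1 := N.smul_mem (2 : ℂ) (hlie z 0 0 hmem)
    rw [cubicBracket_zero_left_zero, hζz, hzW] at h1
    refine (congrArg (· ∈ N.toSubmodule)
      (cubicBracket_ext ?_ (fun g => ?_) (fun w => ?_) ?_)).mpr h1
    · simp only [Prod.smul_fst, smul_eq_mul]; ring
    · simp only [Prod.smul_fst, Prod.smul_snd, map_sub, map_smul, map_neg, smul_eq_mul]; ring
    · simp only [Prod.smul_fst, Prod.smul_snd, LinearMap.add_apply, LinearMap.smul_apply,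
        Module.Dual.lie_apply, smul_eq_mul, hzW]; ring
    · simp only [Prod.smul_snd, smul_eq_mul]; ring
  obtain ⟨v, hv, hv0⟩ : ∃ v ∈ N, v ≠ 0 := by
    by_contra! hcon
    exact hN ((LieSubmodule.eq_bot_iff N).mpr hcon)
  obtain ⟨a, r, s, b⟩ := v
  have h1 := hY hv
  have h2 := hY h1
  have h3 := hY h2
  -- The coefficients used below are those of Lagrange interpolation polynomials in `2z`, each
  -- isolating one summand.
  have hcomb : ∀ c₀ c₁ c₂ c₃ : ℂ, c₀ • (a, r, s, b) + c₁ • (-3 * a, -r, s, 3 * b)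
      + c₂ • (-3 * (-3 * a), - -r, s, 3 * (3 * b))
      + c₃ • (-3 * (-3 * (-3 * a)), - - -r, s, 3 * (3 * (3 * b))) ∈ N := fun c₀ c₁ c₂ c₃ =>
    N.add_mem (N.add_mem (N.add_mem (N.smul_mem _ hv) (N.smul_mem _ h1)) (N.smul_mem _ h2))
      (N.smul_mem _ h3)
  by_cases ha : a = 0
  · by_cases hr : r = 0
    · by_cases hs : s = 0
      · have hb : b ≠ 0 := by
          rintro rfl
          exact hv0 (by rw [ha, hr, hs]; rfl)
        refine htopβ hb ?_
        rwa [ha, hr, hs] at hv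
      · refine htopD hs ?_
        convert hcomb (9 / 16) (9 / 16) (-1 / 16) (-1 / 16) using 1
        simp only [Prod.smul_mk, Prod.mk_add_mk, Prod.mk.injEq, smul_eq_mul]
        refine ⟨?_, ?_, ?_, ?_⟩
        · ring
        · module
        · module
        · ring
    · refine htopW hr ?_
      convert hcomb (9 / 16) (-9 / 16) (-1 / 16) (1 / 16) using 1
      simp only [Prod.smul_mk, Prod.mk_add_mk, Prod.mk.injEq, smul_eq_mul]
      refine ⟨?_, ?_, ?_, ?_⟩
      · ring
      · module
      · module
      · ring
  · refine htop ha ?_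
    convert hcomb (-3 / 48) (1 / 48) (3 / 48) (-1 / 48) using 1
    simp only [Prod.smul_mk, Prod.mk_add_mk, Prod.mk.injEq, smul_eq_mul]
    refine ⟨?_, ?_, ?_, ?_⟩
    · ring
    · module
    · module
    · ring

end Module

/-! ### Simplicity of the graded Lie algebra -/

section Simple

variable {L W : Type*} [LieRing L] [LieAlgebra ℂ L] [Module.Finite ℂ L]
  [AddCommGroup W] [Module ℂ W] [Module.Finite ℂ W] [LieRingModule L W] [LieModule ℂ L W]

/-- Bracketing with `z` splits an ideal along the grading. A nonzero homogeneous element leads into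
`W`, which irreducibility fills; `θ` then spans `L`, and `z` recovers `W*`. -/
theorem GradedLie.isSimple (hirr : LieModule.IsIrreducible ℂ L W)
    (hfaith : LieModule.IsFaithful ℂ L W) {θ : W →ₗ[ℂ] Module.Dual ℂ W →ₗ[ℂ] L}
    (hθ : IsLiePairing θ) (K : LinearMap.BilinForm ℂ L) (hs : K.IsSymm) (hn : K.Nondegenerate)
    (hK : ∀ (x : L) (u : W) (f : Module.Dual ℂ W), K x (θ u f) = f ⁅x, u⁆)
    {z : L} (hz : z ∈ LieAlgebra.center ℂ L) (hzW : ∀ w : W, ⁅z, w⁆ = w) :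
    LieAlgebra.IsSimple ℂ (GradedLie θ hθ) := by
  have hW : Nontrivial W := LieModule.nontrivial_of_isIrreducible ℂ L W
  let mk := GradedLie.mk θ hθ
  have hbr : ∀ x u f y v g, ⁅mk x u f, mk y v g⁆
      = mk (⁅x, y⁆ + θ u g - θ v f) (⁅x, v⁆ - ⁅y, u⁆) (⁅x, g⁆ - ⁅y, f⁆) :=
    fun x u f y v g => rfl
  have hadd : ∀ x u f y v g, mk x u f + mk y v g = mk (x + y) (u + v) (f + g) :=
    fun x u f y v g => rfl
  have hsmul : ∀ (c : ℂ) x u f, c • mk x u f = mk (c • x) (c • u) (c • f) :=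
    fun c x u f => rfl
  have hzx : ∀ x : L, ⁅z, x⁆ = 0 := fun x => by
    rw [← lie_skew, (LieModule.mem_maxTrivSubmodule ℂ L L z).mp hz x, neg_zero]
  have hzf : ∀ f : Module.Dual ℂ W, ⁅z, f⁆ = -f := fun f => LinearMap.ext fun w => by simp [hzW]
  constructor
  · intro I
    refine or_iff_not_imp_left.mpr fun hI => ?_
    have htopW : ∀ {u : W}, u ≠ 0 → mk 0 u 0 ∈ I → I = ⊤ := by
      intro u hu hmem
      let N : LieSubmodule ℂ L W :=
        { carrier := {u | mk 0 u 0 ∈ I}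
          add_mem' := fun {u v} hu hv => by
            have h := I.add_mem hu hv
            rw [hadd, add_zero, add_zero] at h
            exact h
          zero_mem' := I.zero_mem
          smul_mem' := fun c u hu => by
            have h := I.smul_mem c hu
            rw [hsmul, smul_zero, smul_zero] at h
            exact h
          lie_mem := fun {x u} hu => by
            have h1 := lie_mem_right ℂ (GradedLie θ hθ) I (mk x 0 0) _ hu
            rw [hbr] at h1
            simpa using h1 }
      have hN : N = ⊤ := (hirr.eq_bot_or_eq_top N).resolve_left fun h => hu (by
        have : u ∈ N := hmem
        rwa [h, LieSubmodule.mem_bot] at this)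
      have h1 : ∀ u : W, mk 0 u 0 ∈ I := fun u => by
        have : u ∈ N := hN ▸ LieSubmodule.mem_top u
        exact this
      have h2 : ∀ u f, mk (θ u f) 0 0 ∈ I := fun u f => by
        have h3 := lie_mem_left ℂ (GradedLie θ hθ) I _ (mk 0 0 f) (h1 u)
        rw [hbr] at h3
        simpa using h3
      let M : Submodule ℂ L :=
        { carrier := {x | mk x 0 0 ∈ I}
          add_mem' := fun {x y} hx hy => by
            have h := I.add_mem hx hy
            rw [hadd, add_zero, add_zero] at h
            exact h
          zero_mem' := I.zero_mem
          smul_mem' := fun c x hx => by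
            have h := I.smul_mem c hx
            rw [hsmul, smul_zero, smul_zero] at h
            exact h }
      have hM : M = ⊤ := by
        -- The values of `θ` span `L`: if `x` is orthogonal to all of them then `f(x·u) = 0` for all
        -- `u` and `f`, and `x = 0` by faithfulness.
        rw [← LinearMap.BilinForm.orthogonal_orthogonal hn hs.isRefl M]
        have hbot : LinearMap.BilinForm.orthogonal K M = ⊥ := by
          refine (Submodule.eq_bot_iff _).mpr fun x hx => ?_
          rw [LinearMap.BilinForm.mem_orthogonal_iff] at hx
          refine LieModule.ext_of_isFaithful (R := ℂ) (M := W) fun u => ?_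
          rw [zero_lie]
          refine (Module.Dual.ext_iff_eval _ _).mpr fun f => ?_
          rw [← hK, map_zero]
          have h3 : K (θ u f) x = 0 := hx _ (h2 u f)
          rw [← h3]
          exact (hs.eq _ _).symm
        rw [hbot]
        exact Submodule.eq_top_iff'.mpr fun x => by
          simp
      have h3 : ∀ x, mk x 0 0 ∈ I := fun x => by
        have : x ∈ M := hM ▸ Submodule.mem_top
        exact this
      have h4 : ∀ f, mk 0 0 f ∈ I := fun f => by
        have h5 := lie_mem_left ℂ (GradedLie θ hθ) I _ (mk 0 0 (-f)) (h3 z)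
        rw [hbr] at h5
        simpa [hzf] using h5
      refine eq_top_iff.mpr fun a _ => ?_
      have h5 := I.add_mem (I.add_mem (h3 a.1) (h1 a.2.1)) (h4 a.2.2)
      rw [hadd, hadd] at h5
      simp only [add_zero, zero_add] at h5
      exact h5
    have htopL : ∀ {x : L}, x ≠ 0 → mk x 0 0 ∈ I → I = ⊤ := by
      intro x hx hmem
      obtain ⟨u, hu⟩ : ∃ u : W, ⁅x, u⁆ ≠ 0 := by
        by_contra! hcon
        exact hx (LieModule.ext_of_isFaithful (R := ℂ) (M := W) fun u => by rw [hcon, zero_lie])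
      refine htopW hu ?_
      have h1 := lie_mem_left ℂ (GradedLie θ hθ) I _ (mk 0 u 0) hmem
      rw [hbr] at h1
      simpa using h1
    have htopD : ∀ {f : Module.Dual ℂ W}, f ≠ 0 → mk 0 0 f ∈ I → I = ⊤ := by
      intro f hf hmem
      obtain ⟨u, hu⟩ : ∃ u, f u ≠ 0 := by
        by_contra! hcon
        exact hf (LinearMap.ext hcon)
      refine htopL (x := θ u f) (fun h0 => hu ?_) ?_
      · rw [← hzW u, ← hK, h0, map_zero]
      · have h1 := lie_mem_right ℂ (GradedLie θ hθ) I (mk 0 u 0) _ hmem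
        rw [hbr] at h1
        simpa using h1
    obtain ⟨a, ha, ha0⟩ : ∃ a ∈ I, a ≠ 0 := by
      by_contra! hcon
      exact hI ((LieSubmodule.eq_bot_iff I).mpr hcon)
    obtain ⟨x, u, f⟩ := a
    have h0 : mk x u f ∈ I := ha
    -- One bracket with `z` gives `(0, u, -f)` and a second gives `(0, u, f)`; half their sum
    -- isolates `u`.
    have h1 : mk 0 u (-f) ∈ I := by
      have h := lie_mem_right ℂ (GradedLie θ hθ) I (mk z 0 0) _ h0
      rw [hbr] at h
      simpa [hzx, hzW, hzf] using h
    have h2 : mk 0 u f ∈ I := by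
      have h := lie_mem_right ℂ (GradedLie θ hθ) I (mk z 0 0) _ h1
      rw [hbr] at h
      simpa [hzx, hzW, hzf] using h
    by_cases hu : u = 0
    · by_cases hf : f = 0
      · subst hu hf
        exact htopL (fun hx => ha0 (by rw [hx]; rfl)) h0
      · subst hu
        exact htopD hf h2
    · refine htopW hu ?_
      have h := I.smul_mem (1 / 2 : ℂ) (I.add_mem h1 h2)
      rw [hadd, hsmul, add_zero, smul_zero, neg_add_cancel, smul_zero, ← two_smul ℂ u, smul_smul,
        show (1 / 2 : ℂ) * 2 = 1 by norm_num, one_smul] at h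
      exact h
  · intro hab
    obtain ⟨u, hu⟩ := exists_ne (0 : W)
    have h1 : ⁅mk z 0 0, mk 0 u 0⁆ = 0 := hab.trivial _ _
    rw [hbr] at h1
    have h2 : ⁅z, u⁆ - ⁅(0 : L), (0 : W)⁆ = 0 :=
      congrArg (fun a : L × W × Module.Dual ℂ W => a.2.1) h1
    rw [hzW, zero_lie, sub_zero] at h2
    exact hu h2

end Simple

/-! ### The pairing dual to the action -/

section Pairing

variable {L W : Type*} [LieRing L] [LieAlgebra ℂ L]
  [AddCommGroup W] [Module ℂ W] [LieRingModule L W] [LieModule ℂ L W]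
  {ι : Type*} [Fintype ι] {K : LinearMap.BilinForm ℂ L} {ζ : L →ₗ[ℂ] ℂ} {z : L} {b b' : ι → L}

variable (W) in
/-- The bilinear map `W × W* → L` dual to the action of `L` on `W`. -/
def dualPairing (b b' : ι → L) : W →ₗ[ℂ] Module.Dual ℂ W →ₗ[ℂ] L :=
  LinearMap.mk₂ ℂ (fun u f => ∑ i, f ⁅b i, u⁆ • b' i)
    (fun _ _ _ => by simp [add_smul, Finset.sum_add_distrib])
    (fun _ _ _ => by simp [mul_smul, Finset.smul_sum])
    (fun _ _ _ => by simp [add_smul, Finset.sum_add_distrib])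
    (fun _ _ _ => by simp [mul_smul, Finset.smul_sum])

theorem dualPairing_apply (u : W) (f : Module.Dual ℂ W) :
    dualPairing W b b' u f = ∑ i, f ⁅b i, u⁆ • b' i := rfl

theorem apply_dualPairing_lie (u v : W) (f g : Module.Dual ℂ W) :
    g ⁅dualPairing W b b' u f, v⁆ = ∑ i, f ⁅b i, u⁆ * g ⁅b' i, v⁆ := by
  simp [dualPairing_apply, sum_lie]

theorem IsDualPair.apply_dualPairing (hd : IsDualPair K b b') (x : L) (u : W)
    (f : Module.Dual ℂ W) : K x (dualPairing W b b' u f) = f ⁅x, u⁆ := by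
  conv_rhs => rw [← hd.sum_right x, _root_.sum_lie]
  simp [dualPairing_apply, mul_comm]

/-- Equivariance is invariance of `K`. Both symmetry conditions unfold to `T(u ⊗ v) = T(v ⊗ u)`, the
second after exchanging the two dual families. -/
theorem IsNormalizedForm.isLiePairing [Module.Finite ℂ W] (hN : IsNormalizedForm W K ζ z)
    (hd : IsDualPair K b b') (hirr : LieModule.IsIrreducible ℂ L W)
    (halt : altSquare ℂ L W = ⊥ ∨ LieModule.IsIrreducible ℂ L (altSquare ℂ L W)) :
    IsLiePairing (dualPairing W b b') := by
  have hcomm : ∀ (u v : W) (f g : Module.Dual ℂ W),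
      ∑ i, f ⁅b i, u⁆ * g ⁅b' i, v⁆ = ∑ i, f ⁅b i, v⁆ * g ⁅b' i, u⁆ := by
    intro u v f g
    have h : splitCasimir W b b' (u ⊗ₜ v) = splitCasimir W b b' (v ⊗ₜ u) := by
      rw [← sub_eq_zero, ← map_sub]
      refine hN.splitCasimir_eq_zero_of_mem_altSquare hd hirr halt ?_
      change TensorProduct.comm ℂ W W _ = -_
      simp
    have h' := congrArg (fun t => tensorToBilin W t f g) h
    simpa [splitCasimir_tmul, map_sum] using h'
  refine ⟨fun x u f => ?_, fun u v f => ?_, fun u f g => ?_⟩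
  · rw [← sub_eq_zero]
    refine hN.nondegenerate.2 _ fun y => ?_
    rw [map_sub, map_add, ← hN.invariant, hd.apply_dualPairing, hd.apply_dualPairing,
      hd.apply_dualPairing, lie_lie, map_sub, Module.Dual.lie_apply]
    ring
  · refine (Module.Dual.ext_iff_eval _ _).mpr fun g => ?_
    rw [apply_dualPairing_lie, apply_dualPairing_lie, hcomm]
  · ext v
    have hsw : ∑ i, f ⁅b i, v⁆ * g ⁅b' i, u⁆ = ∑ i, f ⁅b' i, v⁆ * g ⁅b i, u⁆ :=
      hd.sum_swap hN.symm (LinearMap.mk₂ ℂ (fun x y => f ⁅x, v⁆ * g ⁅y, u⁆)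
        (by simp [add_mul]) (by simp [mul_assoc]) (by simp [mul_add]) (by simp [mul_left_comm]))
    rw [Module.Dual.lie_apply, Module.Dual.lie_apply, apply_dualPairing_lie,
      apply_dualPairing_lie, hcomm, hsw]
    simp only [mul_comm]

theorem IsNormalizedForm.dual_cubicForm_apply_lie (hN : IsNormalizedForm W K ζ z)
    {C' : CubicForm (Module.Dual ℂ W)} (hC' : C'.IsInvariant (derivedIdeal L))
    (x : L) (f g h : Module.Dual ℂ W) :
    C'.toFun ⁅x, f⁆ g h + C'.toFun f ⁅x, g⁆ h + C'.toFun f g ⁅x, h⁆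
      = -(3 * ζ x) * C'.toFun f g h := by
  obtain ⟨y, hy⟩ := hN.exists_derived_add x
  have h1 : ∀ f : Module.Dual ℂ W, ⁅x, f⁆ = ⁅y, f⁆ - ζ x • f := fun f => by
    conv_lhs => rw [hy, add_lie, smul_lie, hN.lie_dual, smul_neg, ← sub_eq_add_neg]
    rfl
  have h2 := hC' y f g h
  simp only [h1, map_sub, map_smul, LinearMap.sub_apply, LinearMap.smul_apply, smul_eq_mul]
  linear_combination h2

end Pairing

end

/-! ### Assembly of the theorem -/

theorem mainTheorem3 {L W : Type*} [LieRing L] [LieAlgebra ℂ L] [Module.Finite ℂ L]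
    [AddCommGroup W] [Module ℂ W] [Module.Finite ℂ W] [LieRingModule L W] [LieModule ℂ L W]
    (hred : LieAlgebra.HasCentralRadical ℂ L)
    (hcenter : Module.finrank ℂ (LieAlgebra.center ℂ L) = 1)
    (hirr : LieModule.IsIrreducible ℂ L W)
    (hfaith : LieModule.IsFaithful ℂ L W)
    (hnontriv : ∃ z ∈ LieAlgebra.center ℂ L, ∃ w : W, ⁅z, w⁆ ≠ 0)
    (halt : altSquare ℂ L W = ⊥ ∨ LieModule.IsIrreducible ℂ L (altSquare ℂ L W))
    (C : CubicForm W) (hC : C.toFun ≠ 0) (hCinv : C.IsInvariant (derivedIdeal L))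
    (P S : LieSubmodule ℂ (derivedIdeal L) (symSquare ℂ (derivedIdeal L) W))
    (hPS : IsCompl P S)
    (hP : Nonempty (P ≃ₗ⁅ℂ, derivedIdeal L⁆ Module.Dual ℂ W))
    (hS : S = ⊥ ∨ LieModule.IsIrreducible ℂ (derivedIdeal L) S) :
    ∃ (K : LinearMap.BilinForm ℂ L) (θ : W →ₗ[ℂ] Module.Dual ℂ W →ₗ[ℂ] L)
      (hθ : IsLiePairing θ),
      K.IsSymm ∧ K.Nondegenerate ∧ (∀ x y z : L, K ⁅x, y⁆ z = K x ⁅y, z⁆) ∧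
      (∀ (x : L) (u : W) (f : Module.Dual ℂ W), K x (θ u f) = f ⁅x, u⁆) ∧
      LieAlgebra.IsSimple ℂ (GradedLie θ hθ) ∧
      ∃ C' : CubicForm (Module.Dual ℂ W), C'.toFun ≠ 0 ∧ C'.IsInvariant (derivedIdeal L) ∧
        ∃ (_ : LieRingModule (GradedLie θ hθ) (ℂ × W × Module.Dual ℂ W × ℂ))
          (_ : LieModule ℂ (GradedLie θ hθ) (ℂ × W × Module.Dual ℂ W × ℂ)),
          IsCubicAction θ hθ C C' ∧
          LieModule.IsIrreducible ℂ (GradedLie θ hθ) (ℂ × W × Module.Dual ℂ W × ℂ) := by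
  have hW : Nontrivial W := LieModule.nontrivial_of_isIrreducible ℂ L W
  obtain ⟨K, ζ, z, hN⟩ := exists_isNormalizedForm hcenter hirr hfaith hnontriv
  obtain ⟨b, b', hd⟩ := exists_isDualPair K hN.symm hN.nondegenerate
  have hθ := hN.isLiePairing hd hirr halt
  obtain ⟨ψ₀, hψ₀, hsymm, hdec⟩ := hN.exists_decomposition hd hirr P S hPS hP hS
  obtain ⟨C', hC', hC'inv, hcomp⟩ := hN.exists_dual_cubicForm_of_decomposition hd hirr halt C hC
    hCinv ψ₀ hψ₀ hsymm hdec
  have hpair : IsCubicPair (dualPairing W b b') ζ C C' :=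
    { map_lie := hN.map_lie
      map_pairing := fun u f => by
        rw [← hN.apply_center,
          show K (dualPairing W b b' u f) z = K z (dualPairing W b b' u f) from hN.symm.eq _ _,
          hd.apply_dualPairing, hN.lie_self]
      lie_left := hN.cubicForm_apply_lie hCinv
      lie_right := hN.dual_cubicForm_apply_lie hC'inv
      comp := fun t r f g => by rw [hcomp, apply_dualPairing_lie] }
  exact ⟨K, dualPairing W b b', hθ, hN.symm, hN.nondegenerate, hN.invariant, hd.apply_dualPairing,
    GradedLie.isSimple hirr hfaith hθ K hN.symm hN.nondegenerate hd.apply_dualPairing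
      hN.mem_center hN.lie_self,
    C', hC', hC'inv, hpair.lieRingModule hθ, hpair.lieModule hθ,
    hpair.isCubicAction hθ hN.mem_center hN.lie_self hN.map_center fun x hx => hN.map_derived hx,
    hpair.isIrreducible hθ hN.lie_self hN.map_center hC hC'⟩
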